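/- **Setting.** There are $n\ge 1$ arms. Arm $i$ has a reward distribution: a probability measure $P_i$ on a finite sample space $\Omega$ and a random reward $y_i:\Omega\to\mathbb R$ with values in $[0,1]$ ($P_i$-almost surely), with mean $\mu(i)=\sum_\omega P_i(\omega)y_i(\omega)$. It is accessed only through a unitary oracle $\mathcal O_i$ with $\mathcal O_i|0\rangle=\sum_{\omega}\sqrt{P_i(\omega)}\,|\omega\rangle|y_i(\omega)\rangle$; in each round an arm $i_t$ is chosen and $\mathcal O_{i_t}$ or $\mathcal O_{i_t}^\dagger$ may be used at most once. With $i^*$ an arm of largest mean, the regret over $T$ rounds is $R(T)=\sum_{t=1}^T(\mu(i^*)-\mu(i_t))$. **Quantum Monte Carlo.** A Quantum Monte Carlo method with constant $C_1>1$ is a family of quantum query algorithms $\mathrm{QMC}_1(\mathcal O,\varepsilon,\delta)$, $\varepsilon>0$, $\delta\in(0,1)$, which, for every oracle $\mathcal O$ encoding a random variable $y$ with values in $[0,1]$, makes at most $\frac{C_1}{\varepsilon}\log\frac1\delta$ queries to $\mathcal O$ and $\mathcal O^\dagger$ and outputs $\hat y$ with $\Pr(|\hat y-\mathbb E[y]|\ge\varepsilon)\le\delta$.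 ($\log$ is the natural logarithm.) **Algorithm $\mathrm{QUCB}_1(\delta)$.** A stage for arm $i$ with radius $r$ plays arm $i$ for $\max\{1,\lfloor\frac{C_1}{r}\log\frac1\delta\rfloor\}$ consecutive rounds, runs $\mathrm{QMC}_1(\mathcal O_i,r,\delta)$ during them and replaces the estimate $\hat\mu(i)$ by its output. First, each arm $i$ has one stage with radius $r_i=1$. Then, in every further stage, choose $i_s\in\arg\max_i(\hat\mu(i)+r_i)$ (ties broken arbitrarily, possibly depending on the past), halve $r_{i_s}$, and run a stage for $i_s$ with the new radius. The algorithm stops after $T$ rounds. **Theorem.** There are a constant $C_1>1$ and a Quantum Monte Carlo method with constant $C_1$. For every $C_1>1$ and every Quantum Monte Carlo method with constant $C_1$, for every instance with $n$ arms as above, every $\delta\in(0,1)$ and every integer $T\ge nC_1\log\frac1\delta$, with probability at least $$1-n\delta\log_2\!\left(\frac{T}{nC_1\log\frac1\delta}\right)$$ the cumulative regret of $\mathrm{QUCB}_1(\delta)$ satisfies $R(T)\le 8(n-1)C_1\log\frac1\delta$. -/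

import Mathlib

open scoped Matrix Kronecker

noncomputable section

namespace QBandit

/-! ### Reward oracles -/

/-- The registers on which the reward oracles act: a finite sample space `Ω`, a finite set `V` of
real numbers that the value register can hold, and the basis state called `|0⟩`.  The format is
known to the learner. -/
structure Format where
  Ω : Type
  fintypeΩ : Fintype Ω
  decEqΩ : DecidableEq Ω
  V : Finset ℝ
  zero : Ω × V

instance (F : Format) : Fintype F.Ω := F.fintypeΩ

instance (F : Format) : DecidableEq F.Ω := F.decEqΩ

/-- Labels `(ω, v)` of the computational basis `|ω⟩|v⟩` of the oracle registers. -/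
abbrev Format.Basis (F : Format) : Type := F.Ω × F.V

/-- A reward distribution: a probability distribution `P` on `Ω` and a random reward `y`.  A sample
space smaller than `Ω` is represented by `P = 0` off it. -/
structure Reward (F : Format) where
  P : F.Ω → ℝ
  y : F.Ω → F.V
  P_nonneg : ∀ ω, 0 ≤ P ω
  P_sum : ∑ ω, P ω = 1

/-- The expected reward. -/
def Reward.mean {F : Format} (R : Reward F) : ℝ := ∑ ω, R.P ω * (R.y ω : ℝ)

/-- The bounded value assumption: rewards lie in `[0,1]`. -/
def Reward.BoundedValue {F : Format} (R : Reward F) : Prop :=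
  ∀ ω, R.P ω ≠ 0 → (R.y ω : ℝ) ∈ Set.Icc (0 : ℝ) 1

/-- The unitary `O` encodes the reward `R`: `O|0⟩ = ∑ ω, √(P ω) |ω⟩|y ω⟩`. -/
def Encodes {F : Format} (O : Matrix.unitaryGroup F.Basis ℂ) (R : Reward F) : Prop :=
  (O : Matrix F.Basis F.Basis ℂ) *ᵥ Pi.single F.zero 1 =
    ∑ ω, Pi.single (ω, R.y ω) ((Real.sqrt (R.P ω) : ℝ) : ℂ)

/-! ### Quantum query algorithms -/

/-- Quantum programs with a workspace register of dimension `w` next to an oracle register with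
basis `B`.  A program stops with a real output, applies a unitary to all registers, queries the
oracle or its inverse, or performs a measurement (POVM `(K j)ᴴ * K j`, with state `K j ψ` up to
normalization after outcome `j`) and continues depending on the outcome. -/
inductive QProgram (B : Type) [Fintype B] [DecidableEq B] (w : ℕ) : Type
  | output (x : ℝ) : QProgram B w
  | unitary (U : Matrix.unitaryGroup (Fin w × B) ℂ) (next : QProgram B w) : QProgram B w
  | query (inverse : Bool) (next : QProgram B w) : QProgram B w
  | measure (m : ℕ) (K : Fin m → Matrix (Fin w × B) (Fin w × B) ℂ)
      (hK : ∑ j, (K j)ᴴ * K j = 1) (next : Fin m → QProgram B w) : QProgram B w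

namespace QProgram

variable {B : Type} [Fintype B] [DecidableEq B] {w : ℕ}

/-- Worst-case number of queries to the oracle and its inverse. -/
def queries : QProgram B w → ℕ
  | output _ => 0
  | unitary _ next => next.queries
  | query _ next => next.queries + 1
  | measure _ _ _ next => Finset.univ.sup fun j => (next j).queries

/-- The oracle (or its inverse) acting on the oracle register, identity on the workspace. -/
def queryMatrix (w : ℕ) (O : Matrix.unitaryGroup B ℂ) (inverse : Bool) :
    Matrix (Fin w × B) (Fin w × B) ℂ :=
  (1 : Matrix (Fin w) (Fin w) ℂ) ⊗ₖ
    (if inverse then (O : Matrix B B ℂ)ᴴ else (O : Matrix B B ℂ))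

/-- Squared norm of a state vector. -/
def normSq {ι : Type} [Fintype ι] (ψ : ι → ℂ) : ℝ := ∑ a, ‖ψ a‖ ^ 2

/-- `p.weight O ψ x` is the probability that the program `p`, started on `ψ`, outputs `x` (Born
rule); state vectors are not renormalized after a measurement, so that the probability of a branch
is the squared norm of its final vector. -/
def weight (O : Matrix.unitaryGroup B ℂ) :
    QProgram B w → (Fin w × B → ℂ) → ℝ → ENNReal
  | output x, ψ => Pi.single x (ENNReal.ofReal (normSq ψ))
  | unitary U next, ψ => next.weight O ((U : Matrix (Fin w × B) (Fin w × B) ℂ) *ᵥ ψ)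
  | query inverse next, ψ => next.weight O (queryMatrix w O inverse *ᵥ ψ)
  | measure _ K _ next, ψ => fun x => ∑ j, (next j).weight O (K j *ᵥ ψ) x

theorem normSq_eq {ι : Type} [Fintype ι] (ψ : ι → ℂ) :
    ((normSq ψ : ℝ) : ℂ) = star ψ ⬝ᵥ ψ := by
  simp only [normSq, dotProduct, Pi.star_apply, RCLike.star_def, Complex.conj_mul']
  push_cast
  rfl

theorem normSq_sum {ι : Type} [Fintype ι] [DecidableEq ι] {m : ℕ} (K : Fin m → Matrix ι ι ℂ)
    (hK : ∑ j, (K j)ᴴ * K j = 1) (ψ : ι → ℂ) : ∑ j, normSq (K j *ᵥ ψ) = normSq ψ := by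
  have h : ((∑ j, normSq (K j *ᵥ ψ) : ℝ) : ℂ) = ((normSq ψ : ℝ) : ℂ) := by
    push_cast
    simp only [normSq_eq, Matrix.star_mulVec, ← Matrix.dotProduct_mulVec, Matrix.mulVec_mulVec]
    rw [← dotProduct_sum, ← Matrix.sum_mulVec, hK, Matrix.one_mulVec]
  exact_mod_cast h

theorem normSq_isometry {ι : Type} [Fintype ι] [DecidableEq ι] (K : Matrix ι ι ℂ)
    (hK : Kᴴ * K = 1) (ψ : ι → ℂ) : normSq (K *ᵥ ψ) = normSq ψ := by
  simpa using normSq_sum (m := 1) (fun _ => K) (by simpa using hK) ψ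

theorem queryMatrix_isometry (O : Matrix.unitaryGroup B ℂ) (inverse : Bool) :
    (queryMatrix w O inverse)ᴴ * queryMatrix w O inverse = 1 := by
  have h1 : (O : Matrix B B ℂ)ᴴ * (O : Matrix B B ℂ) = 1 := Matrix.UnitaryGroup.star_mul_self O
  have h2 : (O : Matrix B B ℂ) * (O : Matrix B B ℂ)ᴴ = 1 := mul_eq_one_comm.mp h1
  cases inverse <;>
    simp [queryMatrix, Matrix.conjTranspose_kronecker, ← Matrix.mul_kronecker_mul, h1, h2]

theorem tsum_weight (O : Matrix.unitaryGroup B ℂ) (p : QProgram B w) :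
    ∀ ψ, ∑' x, p.weight O ψ x = ENNReal.ofReal (normSq ψ) := by
  induction p with
  | output x => intro ψ; simp only [weight]; exact tsum_pi_single x _
  | unitary U next ih =>
    intro ψ
    simp only [weight]
    rw [ih, normSq_isometry _ (Matrix.UnitaryGroup.star_mul_self U)]
  | query inverse next ih =>
    intro ψ
    simp only [weight]
    rw [ih, normSq_isometry _ (queryMatrix_isometry O inverse)]
  | measure m K hK next ih =>
    intro ψ
    simp only [weight]
    rw [Summable.tsum_finsetSum (fun _ _ => ENNReal.summable)]
    simp only [ih]
    rw [← ENNReal.ofReal_sum_of_nonneg, normSq_sum K hK]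
    intro j _
    exact Finset.sum_nonneg fun _ _ => by positivity

end QProgram

/-- A quantum query algorithm with real output: a workspace of dimension `w + 1` and a program. -/
structure QAlgorithm (F : Format) where
  w : ℕ
  program : QProgram F.Basis (w + 1)

/-- The initial state `|0⟩|0⟩` of the workspace and the oracle registers. -/
def QAlgorithm.start {F : Format} (A : QAlgorithm F) : Fin (A.w + 1) × F.Basis → ℂ :=
  Pi.single (0, F.zero) 1

theorem QAlgorithm.normSq_start {F : Format} (A : QAlgorithm F) :
    QProgram.normSq A.start = 1 := by
  unfold QProgram.normSq QAlgorithm.start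
  rw [Finset.sum_eq_single (0, F.zero)]
  · simp
  · intro b _ hb
    simp [Pi.single_eq_of_ne hb]
  · simp

/-- The distribution of the output of the algorithm when it is run with the oracle `O`. -/
def QAlgorithm.law {F : Format} (A : QAlgorithm F) (O : Matrix.unitaryGroup F.Basis ℂ) : PMF ℝ :=
  ⟨A.program.weight O A.start, by
    have h := QProgram.tsum_weight O A.program A.start
    rw [A.normSq_start, ENNReal.ofReal_one] at h
    exact h ▸ ENNReal.summable.hasSum⟩

/-! ### Quantum Monte Carlo -/

/-- `Q` is a Quantum Monte Carlo method with constant `C`: for all `ε > 0` and `δ ∈ (0,1)`, the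
algorithm `Q F ε δ` makes at most `(C/ε) log(1/δ)` queries, and for every oracle `O` that encodes
a reward with values in `[0,1]` its output misses the mean by `ε` or more with probability at most
`δ`. -/
def IsQMC (C : ℝ) (Q : (F : Format) → (ε δ : ℝ) → QAlgorithm F) : Prop :=
  ∀ (F : Format) (ε δ : ℝ), 0 < ε → 0 < δ → δ < 1 →
    ((Q F ε δ).program.queries : ℝ) ≤ C / ε * Real.log (1 / δ) ∧
    ∀ (R : Reward F) (O : Matrix.unitaryGroup F.Basis ℂ), R.BoundedValue → Encodes O R →
      ((Q F ε δ).law O).toMeasure.real {x | ε ≤ |x - R.mean|} ≤ δ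

/-! ### The algorithm QUCB -/

/-- State of the algorithm at the end of a stage. -/
structure State (n : ℕ) where
  /-- current estimates of the means -/
  muHat : Fin n → ℝ
  /-- current confidence radii -/
  r : Fin n → ℝ
  /-- the arms of all rounds so far, in order -/
  played : List (Fin n)
  /-- arms and outcomes of all estimations so far, in order -/
  history : List (Fin n × ℝ)

/-- Number of rounds of a stage with target accuracy `ε`: `(C/ε) log(1/δ)` rounded down to an
integer, but at least one round. -/
def stageLength (C δ ε : ℝ) : ℕ := max 1 ⌊C / ε * Real.log (1 / δ)⌋₊

section Algorithm

variable {n : ℕ} {F : Format} (C δ : ℝ) (Q : (F : Format) → (ε δ : ℝ) → QAlgorithm F)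
  (O : Fin n → Matrix.unitaryGroup F.Basis ℂ)

/-- One stage: set the radius of arm `i` to `ε`, play `i` for `stageLength C δ ε` rounds while
running `Q F ε δ` with the oracle of `i`, and store the new estimate. -/
def runStage (i : Fin n) (ε : ℝ) (s : State n) : PMF (State n) :=
  ((Q F ε δ).law (O i)).map fun x =>
    { muHat := Function.update s.muHat i x
      r := Function.update s.r i ε
      played := s.played ++ List.replicate (stageLength C δ ε) i
      history := s.history ++ [(i, x)] }

/-- Initialization: one stage with radius `1` for each of the arms `i = 0, …, n - 1`. -/
def initialPhase : PMF (State n) :=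
  (List.finRange n).foldlM (fun s i => runStage C δ Q O i 1 s)
    { muHat := fun _ => 0, r := fun _ => 1, played := [], history := [] }

/-- The main loop, with `fuel` bounding the number of stages: as long as fewer than `T` rounds have
been played, halve the radius of the arm `select s` and run a stage with it. -/
def mainLoop (select : State n → Fin n) (T : ℕ) : ℕ → State n → PMF (State n)
  | 0, s => PMF.pure s
  | fuel + 1, s =>
    if T ≤ s.played.length then PMF.pure s
    else (runStage C δ Q O (select s) (s.r (select s) / 2) s).bind (mainLoop select T fuel)

/-- `QUCB₁(δ)` with horizon `T`: the distribution of the arms of the first `T` rounds.  Every stage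
has at least one round, so `T` stages suffice.  If the horizon falls inside a stage, only the rounds
of that stage before the horizon count. -/
def qucb (select : State n → Fin n) (T : ℕ) : PMF (List (Fin n)) :=
  ((initialPhase C δ Q O).bind (mainLoop C δ Q O select T T)).map fun s => s.played.take T

end Algorithm

/-- The selection rule picks an arm that maximizes the upper confidence bound `muHat i + r i`; ties
are broken in an arbitrary way that may depend on the whole past. -/
def IsUCBRule {n : ℕ} (select : State n → Fin n) : Prop :=
  ∀ (s : State n) (j : Fin n), s.muHat j + s.r j ≤ s.muHat (select s) + s.r (select s)

/-- Cumulative regret of a sequence of arms, with respect to the arm `best`. -/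
def regret {n : ℕ} (μ : Fin n → ℝ) (best : Fin n) (arms : List (Fin n)) : ℝ :=
  (arms.map fun i => μ best - μ i).sum

end QBandit

end

/-! A Quantum Monte Carlo method exists because the mean is an eigenphase. Conjugating by the oracle
a qubit reflection with diagonal entry `1 - 2 y` gives a reflection W with ⟨e, W e⟩ = 1 - 2μ, where
e is the start state. Composed with the reflection about e it is a walk for which e is an equal
mixture of phases ±α, with cos α = 1 - 2μ (`walkMatrix_moments`). A phase estimation with M steps
costs 2M queries. If the counter is prepared in a power of the Dirichlet kernel, the failure
probability of a single run decays exponentially in the exponent (`sum_outcomeProb_le`), which gives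
the factor log(1/δ) without taking medians. When δ is near 1 the query budget tends to 0, and a flat
window with one well-placed outcome suffices.

For the regret, write x = C log(1/δ), τ = T/(nx) and Δ for the gap of an arm. A union bound over all
stages would depend on how many stages rounding and the cut at T allow, so only n - 1 + K estimates
are required to succeed. For each suboptimal arm this is the single estimate at which 2r first drops
below Δ: if it is correct, the upper bound of that arm stays below the best mean, so the arm is not
selected while the upper bound of the best arm is valid. Then 2^c Δ ≤ 8 after c stages, and the arm
costs at most 8x. For the best arm these are the first K estimates. If it gets beyond them, it has
filled all but 8x of the T rounds, and the other arms together cost at most 8x.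

The invariant is `Good`, the union bound is driven by the potential `remaining`, and K = ⌊n log₂ τ⌋
- (n - 1) makes the total failure probability at most δ n log₂ τ. That this K is large enough is the
numerical inequality `two_pow_le_pow`. -/

noncomputable section

namespace QBandit

/-! ### Chebyshev moments of a quantum walk -/

section Walk

variable {ι : Type} [Fintype ι] [DecidableEq ι]

/-- Applying powers of G to `h2` gives the Chebyshev recurrence for the vectors G^n e, and unitarity
makes the Gram matrix depend on n - m only. -/
theorem gram_pow_mulVec {G : Matrix ι ι ℂ} (hG : Gᴴ * G = 1) {e : ι → ℂ} {α : ℝ}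
    (he : star e ⬝ᵥ e = 1) (h1 : star e ⬝ᵥ (G *ᵥ e) = (Real.cos α : ℂ))
    (h2 : G *ᵥ e + Gᴴ *ᵥ e = ((2 * Real.cos α : ℝ) : ℂ) • e) (m n : ℕ) :
    star ((G ^ m) *ᵥ e) ⬝ᵥ ((G ^ n) *ᵥ e) = (Real.cos (((n : ℝ) - m) * α) : ℂ) := by
  have hG' : G * Gᴴ = 1 := mul_eq_one_comm.mp hG
  have hrec : ∀ n : ℕ, (G ^ (n + 2)) *ᵥ e =
      ((2 * Real.cos α : ℝ) : ℂ) • ((G ^ (n + 1)) *ᵥ e) - (G ^ n) *ᵥ e := by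
    intro n
    rw [eq_sub_iff_add_eq, ← Matrix.mulVec_smul, ← h2, Matrix.mulVec_add, Matrix.mulVec_mulVec,
      Matrix.mulVec_mulVec, ← pow_succ, pow_succ G n, mul_assoc (G ^ n), hG', mul_one]
  have hshift : ∀ m n : ℕ, star ((G ^ (m + 1)) *ᵥ e) ⬝ᵥ ((G ^ (n + 1)) *ᵥ e) =
      star ((G ^ m) *ᵥ e) ⬝ᵥ ((G ^ n) *ᵥ e) := by
    intro m n
    rw [pow_succ', pow_succ', ← Matrix.mulVec_mulVec, ← Matrix.mulVec_mulVec, Matrix.star_mulVec,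
      ← Matrix.dotProduct_mulVec, Matrix.mulVec_mulVec, hG, Matrix.one_mulVec]
  have hzero : ∀ n : ℕ, star e ⬝ᵥ ((G ^ n) *ᵥ e) = (Real.cos (n * α) : ℂ) ∧
      star e ⬝ᵥ ((G ^ (n + 1)) *ᵥ e) = (Real.cos ((n + 1 : ℕ) * α) : ℂ) := by
    intro n
    induction n with
    | zero => simp [he, h1]
    | succ n ih =>
      refine ⟨ih.2, ?_⟩
      rw [hrec, dotProduct_sub, dotProduct_smul, ih.1, ih.2, smul_eq_mul]
      norm_cast
      have := Real.cos_add (((n + 1 : ℕ) : ℝ) * α) α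
      have h' := Real.cos_sub (((n + 1 : ℕ) : ℝ) * α) α
      have e1 : ((n + 1 + 1 : ℕ) : ℝ) * α = ((n + 1 : ℕ) : ℝ) * α + α := by push_cast; ring
      have e2 : (n : ℝ) * α = ((n + 1 : ℕ) : ℝ) * α - α := by push_cast; ring
      rw [e1, e2]
      linear_combination (-1 : ℝ) * h' - this
  induction m generalizing n with
  | zero => simpa using (hzero n).1
  | succ m ih =>
    cases n with
    | zero =>
      have h := (hzero (m + 1)).1
      have h' := congrArg star h
      rw [Matrix.star_dotProduct, star_star] at h'
      simp only [pow_zero, Matrix.one_mulVec]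
      rw [dotProduct_comm] at h'
      rw [dotProduct_comm, h', RCLike.star_def, Complex.conj_ofReal]
      rw [← Real.cos_neg]
      push_cast
      congr 2
      ring
    | succ n =>
      rw [hshift, ih]
      congr 2
      push_cast
      ring

/-- Writing the cosine as a mean of two exponentials splits the Gram form into two rank-one forms.
No diagonalization of G is needed, and the degenerate cases cos α = ±1 are included. -/
theorem normSq_sum_pow_mulVec {G : Matrix ι ι ℂ} (hG : Gᴴ * G = 1) {e : ι → ℂ} {α : ℝ}
    (he : star e ⬝ᵥ e = 1) (h1 : star e ⬝ᵥ (G *ᵥ e) = (Real.cos α : ℂ))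
    (h2 : G *ᵥ e + Gᴴ *ᵥ e = ((2 * Real.cos α : ℝ) : ℂ) • e) {M : ℕ} (d : Fin M → ℂ) :
    QProgram.normSq (∑ m : Fin M, d m • ((G ^ (m : ℕ)) *ᵥ e)) =
      (‖∑ m : Fin M, d m * Complex.exp (α * Complex.I) ^ (m : ℕ)‖ ^ 2 +
        ‖∑ m : Fin M, d m * Complex.exp (-α * Complex.I) ^ (m : ℕ)‖ ^ 2) / 2 := by
  have hcast : ∀ z : ℂ, ((‖z‖ ^ 2 : ℝ) : ℂ) = star z * z := by
    intro z
    rw [RCLike.star_def, Complex.conj_mul']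
    push_cast; rfl
  have key : ((QProgram.normSq (∑ m : Fin M, d m • ((G ^ (m : ℕ)) *ᵥ e)) : ℝ) : ℂ) =
      (((‖∑ m : Fin M, d m * Complex.exp (α * Complex.I) ^ (m : ℕ)‖ ^ 2 +
        ‖∑ m : Fin M, d m * Complex.exp (-α * Complex.I) ^ (m : ℕ)‖ ^ 2) / 2 : ℝ) : ℂ) := by
    rw [QProgram.normSq_eq, Complex.ofReal_div, Complex.ofReal_add, hcast, hcast]
    simp only [star_sum, sum_dotProduct, dotProduct_sum, star_smul, smul_dotProduct,
      dotProduct_smul, gram_pow_mulVec hG he h1 h2, star_mul', star_pow, Finset.sum_mul,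
      Finset.mul_sum, ← Finset.sum_add_distrib, Finset.sum_div, smul_eq_mul]
    refine Finset.sum_congr rfl fun m _ => Finset.sum_congr rfl fun n _ => ?_
    simp only [RCLike.star_def, ← Complex.exp_conj, map_mul, map_neg, Complex.conj_I,
      Complex.conj_ofReal, ← Complex.exp_nat_mul]
    rw [Complex.ofReal_cos, Complex.cos]
    have e1 : ∀ u v a b : ℂ, u * Complex.exp a * (v * Complex.exp b) =
        u * v * Complex.exp (a + b) := by
      intro u v a b; rw [Complex.exp_add]; ring
    rw [e1, e1]
    push_cast
    ring_nf
  exact_mod_cast key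

end Walk

/-! ### Programs with a counter register and a qubit -/

namespace QProgram

theorem weight_zero {B : Type} [Fintype B] [DecidableEq B] {w : ℕ} (O : Matrix.unitaryGroup B ℂ)
    (p : QProgram B w) (x : ℝ) : p.weight O 0 x = 0 := by
  have h := tsum_weight O p 0
  rw [show normSq (0 : Fin w × B → ℂ) = 0 by simp [normSq], ENNReal.ofReal_zero,
    ENNReal.tsum_eq_zero] at h
  exact h x

end QProgram

section Counter

variable {B : Type} {M : ℕ}

/-- Splits the workspace into a counter register and a qubit, and groups the qubit with the oracle
register. -/
def counterEquiv (B : Type) (M : ℕ) : Fin (2 * M + 1 + 1) × B ≃ Fin (M + 1) × (Fin 2 × B) :=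
  ((((finProdFinEquiv (m := 2) (n := M + 1)).symm.trans (Equiv.prodComm _ _)).prodCongr
    (Equiv.refl B)).trans (Equiv.prodAssoc _ _ _))

theorem counterEquiv_zero (b : B) : counterEquiv B M (0, b) = (0, (0, b)) := by
  have h : (finProdFinEquiv (m := 2) (n := M + 1)).symm 0 = (0, 0) := by
    rw [Equiv.symm_apply_eq]
    ext
    simp
  simp [counterEquiv, Prod.map, h]

/-- The state with the vector `Φ m` in the block where the counter is `m`. -/
def blockVec (Φ : Fin (M + 1) → Fin 2 × B → ℂ) : Fin (2 * M + 1 + 1) × B → ℂ :=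
  fun p => Φ (counterEquiv B M p).1 (counterEquiv B M p).2

variable [Fintype B]

theorem normSq_blockVec (Φ : Fin (M + 1) → Fin 2 × B → ℂ) :
    QProgram.normSq (blockVec Φ) = ∑ m, QProgram.normSq (Φ m) := by
  unfold QProgram.normSq blockVec
  rw [← Fintype.sum_prod_type']
  exact Fintype.sum_equiv (counterEquiv B M) _ _ fun _ => rfl

/-- The operator that applies `U m` if the counter is `m`. -/
def controlled (U : Fin (M + 1) → Matrix (Fin 2 × B) (Fin 2 × B) ℂ) :
    Matrix (Fin (2 * M + 1 + 1) × B) (Fin (2 * M + 1 + 1) × B) ℂ :=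
  (Matrix.blockDiagonal U).submatrix ((counterEquiv B M).trans (Equiv.prodComm _ _))
    ((counterEquiv B M).trans (Equiv.prodComm _ _))

theorem controlled_mulVec (U : Fin (M + 1) → Matrix (Fin 2 × B) (Fin 2 × B) ℂ)
    (Φ : Fin (M + 1) → Fin 2 × B → ℂ) :
    controlled U *ᵥ blockVec Φ = blockVec fun m => U m *ᵥ Φ m := by
  unfold controlled
  rw [Matrix.submatrix_mulVec_equiv]
  ext p
  simp only [Function.comp_apply, Equiv.trans_apply, blockVec, Matrix.mulVec, dotProduct,
    Matrix.blockDiagonal_apply, Equiv.prodComm_apply, Prod.snd_swap, Prod.fst_swap,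
    Fintype.sum_prod_type_right, Equiv.symm_trans_apply, Equiv.prodComm_symm,
    Equiv.apply_symm_apply]
  rw [Finset.sum_eq_single (counterEquiv B M p).1]
  · simp
  · intro m _ hm
    simp [hm.symm]
  · simp

variable [DecidableEq B]

theorem controlled_isometry {U : Fin (M + 1) → Matrix (Fin 2 × B) (Fin 2 × B) ℂ}
    (hU : ∀ m, (U m)ᴴ * U m = 1) : (controlled U)ᴴ * controlled U = 1 := by
  unfold controlled
  rw [Matrix.conjTranspose_submatrix, Matrix.submatrix_mul_equiv,
    Matrix.blockDiagonal_conjTranspose, ← Matrix.blockDiagonal_mul]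
  simp only [hU]
  rw [show (fun _ : Fin (M + 1) => (1 : Matrix (Fin 2 × B) (Fin 2 × B) ℂ)) = 1 from rfl,
    Matrix.blockDiagonal_one, Matrix.submatrix_one_equiv]

theorem queryMatrix_mulVec (O : Matrix.unitaryGroup B ℂ) (inverse : Bool)
    (Φ : Fin (M + 1) → Fin 2 × B → ℂ) :
    QProgram.queryMatrix (2 * M + 1 + 1) O inverse *ᵥ blockVec Φ =
      blockVec fun m => QProgram.queryMatrix 2 O inverse *ᵥ Φ m := by
  rw [← controlled_mulVec]
  congr 1
  ext ⟨a, b⟩ ⟨a', b'⟩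
  have h : ∀ a b, counterEquiv B M (a, b) = ((finProdFinEquiv (m := 2) (n := M + 1)).symm a |>.2,
      ((finProdFinEquiv (m := 2) (n := M + 1)).symm a |>.1, b)) := fun _ _ => rfl
  simp only [QProgram.queryMatrix, Matrix.kroneckerMap_apply, controlled, Matrix.submatrix_apply,
    Equiv.trans_apply, Matrix.blockDiagonal_apply, Equiv.prodComm_apply, Prod.snd_swap,
    Prod.fst_swap, h, Matrix.one_apply]
  by_cases haa : a = a'
  · simp [haa]
  · have : ¬ (((finProdFinEquiv (m := 2) (n := M + 1)).symm a).2 =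
        ((finProdFinEquiv (m := 2) (n := M + 1)).symm a').2 ∧
        ((finProdFinEquiv (m := 2) (n := M + 1)).symm a).1 =
        ((finProdFinEquiv (m := 2) (n := M + 1)).symm a').1) := by
      rintro ⟨h1, h2⟩
      exact haa ((finProdFinEquiv (m := 2) (n := M + 1)).symm.injective (Prod.ext h2 h1))
    by_cases h1 : ((finProdFinEquiv (m := 2) (n := M + 1)).symm a).2 =
        ((finProdFinEquiv (m := 2) (n := M + 1)).symm a').2
    · rw [if_neg haa, if_pos h1, if_neg (fun h2 => this ⟨h1, h2⟩)]
    · rw [if_neg haa, if_neg h1, zero_mul]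

/-- The operator `A` on the counter register. -/
def onCounter (B : Type) [DecidableEq B] (A : Matrix (Fin (M + 1)) (Fin (M + 1)) ℂ) :
    Matrix (Fin (2 * M + 1 + 1) × B) (Fin (2 * M + 1 + 1) × B) ℂ :=
  (A ⊗ₖ (1 : Matrix (Fin 2 × B) (Fin 2 × B) ℂ)).submatrix (counterEquiv B M) (counterEquiv B M)

theorem onCounter_mulVec (A : Matrix (Fin (M + 1)) (Fin (M + 1)) ℂ)
    (Φ : Fin (M + 1) → Fin 2 × B → ℂ) :
    onCounter B A *ᵥ blockVec Φ = blockVec fun m => ∑ m', A m m' • Φ m' := by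
  unfold onCounter
  rw [Matrix.submatrix_mulVec_equiv]
  ext p
  simp only [Function.comp_apply, blockVec, Matrix.mulVec, dotProduct,
    Matrix.kroneckerMap_apply, Fintype.sum_prod_type, Equiv.apply_symm_apply, Finset.sum_apply,
    Pi.smul_apply, smul_eq_mul]
  refine Finset.sum_congr rfl fun m _ => ?_
  rw [← Fintype.sum_prod_type' (f := fun q b =>
    A (counterEquiv B M p).1 m * (1 : Matrix (Fin 2 × B) (Fin 2 × B) ℂ) (counterEquiv B M p).2
      (q, b) * Φ m (q, b))]
  simp [Matrix.one_apply]

theorem sum_onCounter {N : ℕ} (A : Fin N → Matrix (Fin (M + 1)) (Fin (M + 1)) ℂ)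
    (hA : ∑ j, (A j)ᴴ * A j = 1) : ∑ j, (onCounter B (A j))ᴴ * onCounter B (A j) = 1 := by
  have h : ∀ j, (onCounter B (A j))ᴴ * onCounter B (A j) = onCounter B ((A j)ᴴ * A j) := by
    intro j
    unfold onCounter
    rw [Matrix.conjTranspose_submatrix, Matrix.submatrix_mul_equiv,
      Matrix.conjTranspose_kronecker, ← Matrix.mul_kronecker_mul, Matrix.conjTranspose_one, one_mul]
  have h1 : onCounter B (1 : Matrix (Fin (M + 1)) (Fin (M + 1)) ℂ) = 1 := by
    unfold onCounter
    rw [Matrix.one_kronecker_one, Matrix.submatrix_one_equiv]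
  rw [← h1, ← hA]
  simp only [h]
  ext p p'
  simp only [onCounter, Matrix.sum_apply, Matrix.submatrix_apply, Matrix.kroneckerMap_apply,
    Finset.sum_mul]

/-! ### The walk program -/

/-- `steps` controlled steps of the walk `S Q† H Q`, the `t`-th one (counted from `t`) acting if the
counter exceeds `t`. -/
def walkLoop (H S : Matrix.unitaryGroup (Fin 2 × B) ℂ) (fin : QProgram B (2 * M + 1 + 1)) :
    (steps t : ℕ) → QProgram B (2 * M + 1 + 1)
  | 0, _ => fin
  -- The queries are made whatever the counter holds, since no controlled oracle is available. Only
  -- the two reflections are controlled.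
  | steps + 1, t =>
    .query false <| .unitary
      ⟨controlled fun m => if t < m then (H : Matrix (Fin 2 × B) (Fin 2 × B) ℂ) else 1, by
        rw [Matrix.mem_unitaryGroup_iff', Matrix.star_eq_conjTranspose]
        refine controlled_isometry fun m => ?_
        split_ifs
        · exact Matrix.UnitaryGroup.star_mul_self H
        · simp⟩ <|
    .query true <| .unitary
      ⟨controlled fun m => if t < m then (S : Matrix (Fin 2 × B) (Fin 2 × B) ℂ) else 1, by
        rw [Matrix.mem_unitaryGroup_iff', Matrix.star_eq_conjTranspose]
        refine controlled_isometry fun m => ?_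
        split_ifs
        · exact Matrix.UnitaryGroup.star_mul_self S
        · simp⟩ <|
    walkLoop H S fin steps (t + 1)

theorem queries_walkLoop (H S : Matrix.unitaryGroup (Fin 2 × B) ℂ)
    (fin : QProgram B (2 * M + 1 + 1)) (steps t : ℕ) :
    (walkLoop H S fin steps t).queries = fin.queries + 2 * steps := by
  induction steps generalizing t with
  | zero => rfl
  | succ s ih => simp only [walkLoop, QProgram.queries, ih]; ring

/-- Loop invariant: before step t, block m has undergone min(m, t) walk steps. In blocks with m ≤ t
the query and its inverse cancel. -/
theorem weight_walkLoop (O : Matrix.unitaryGroup B ℂ) (H S : Matrix.unitaryGroup (Fin 2 × B) ℂ)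
    (fin : QProgram B (2 * M + 1 + 1)) (e : Fin 2 × B → ℂ) (c : Fin (M + 1) → ℂ)
    (G : Matrix (Fin 2 × B) (Fin 2 × B) ℂ)
    (hG : G = (S : Matrix (Fin 2 × B) (Fin 2 × B) ℂ) * (QProgram.queryMatrix 2 O true *
      ((H : Matrix (Fin 2 × B) (Fin 2 × B) ℂ) * QProgram.queryMatrix 2 O false)))
    (steps t : ℕ) :
    (walkLoop H S fin steps t).weight O
        (blockVec fun m => c m • ((G ^ min (m : ℕ) t) *ᵥ e)) =
      fin.weight O (blockVec fun m => c m • ((G ^ min (m : ℕ) (t + steps)) *ᵥ e)) := by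
  induction steps generalizing t with
  | zero => rfl
  | succ s ih =>
    simp only [walkLoop, QProgram.weight, queryMatrix_mulVec, controlled_mulVec]
    rw [show t + (s + 1) = t + 1 + s by ring, ← ih]
    congr 2
    ext1 m
    have hQ : QProgram.queryMatrix 2 O true * QProgram.queryMatrix 2 O false = 1 := by
      have := QProgram.queryMatrix_isometry (w := 2) O false
      rwa [show (QProgram.queryMatrix 2 O false)ᴴ = QProgram.queryMatrix 2 O true by
        simp [QProgram.queryMatrix, Matrix.conjTranspose_kronecker]] at this
    simp only [Matrix.mulVec_smul, Matrix.mulVec_mulVec]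
    congr 2
    split_ifs with h
    · rw [min_eq_right h.le, min_eq_right (Nat.succ_le_of_lt h), pow_succ', ← mul_assoc,
        ← mul_assoc, ← mul_assoc, hG]
      simp only [mul_assoc]
    · rw [not_lt] at h
      rw [min_eq_left h, min_eq_left (h.trans t.le_succ), one_mul, one_mul, ← mul_assoc, hQ,
        one_mul]

end Counter

/-! ### The reward reflection -/

/-- The reflection of a qubit with entry `1 - 2 t` at `(0, 0)`. -/
def qubitReflection (t : ℝ) : Matrix (Fin 2) (Fin 2) ℂ :=
  !![((1 - 2 * t : ℝ) : ℂ), ((2 * √(t * (1 - t)) : ℝ) : ℂ);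
    ((2 * √(t * (1 - t)) : ℝ) : ℂ), ((2 * t - 1 : ℝ) : ℂ)]

theorem qubitReflection_conjTranspose (t : ℝ) : (qubitReflection t)ᴴ = qubitReflection t := by
  ext i j
  fin_cases i <;> fin_cases j <;> simp [qubitReflection, Matrix.conjTranspose_apply]

theorem qubitReflection_mul_self {t : ℝ} (h0 : 0 ≤ t) (h1 : t ≤ 1) :
    qubitReflection t * qubitReflection t = 1 := by
  have h : √(t * (1 - t)) ^ 2 = t * (1 - t) :=
    Real.sq_sqrt (mul_nonneg h0 (by linarith))
  ext i j
  fin_cases i <;> fin_cases j <;>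
    simp only [qubitReflection, Matrix.mul_apply, Fin.sum_univ_two, Fin.zero_eta, Fin.mk_one,
      Matrix.of_apply, Matrix.cons_val_zero, Matrix.cons_val_one, Matrix.cons_val',
      Matrix.cons_val_fin_one, ne_eq, zero_ne_one, one_ne_zero, not_false_eq_true,
      Matrix.one_apply_eq, Matrix.one_apply_ne] <;> norm_cast <;> nlinarith [h]

/-- Truncation to `[0, 1]`. -/
def clamp (v : ℝ) : ℝ := max 0 (min v 1)

theorem clamp_of_mem {v : ℝ} (h : v ∈ Set.Icc (0 : ℝ) 1) : clamp v = v := by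
  simp [clamp, h.1, h.2]

variable (F : Format)

/-- The reflection of the qubit that is controlled by the value register. -/
def rewardMatrix : Matrix (Fin 2 × F.Basis) (Fin 2 × F.Basis) ℂ :=
  Matrix.blockDiagonal fun b : F.Basis => qubitReflection (clamp b.2)

theorem rewardMatrix_conjTranspose : (rewardMatrix F)ᴴ = rewardMatrix F := by
  simp only [rewardMatrix, Matrix.blockDiagonal_conjTranspose, qubitReflection_conjTranspose]

theorem rewardMatrix_mul_self : rewardMatrix F * rewardMatrix F = 1 := by
  -- The value register may hold reals outside [0,1]; truncation keeps the operator unitary on them.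
  have h : ∀ v : ℝ, qubitReflection (clamp v) * qubitReflection (clamp v) = 1 := fun v =>
    qubitReflection_mul_self (le_max_left _ _) (max_le zero_le_one (min_le_right _ _))
  rw [rewardMatrix, ← Matrix.blockDiagonal_mul]
  simp only [h]
  exact Matrix.blockDiagonal_one

/-- The unitary of `rewardMatrix`. -/
def rewardUnitary : Matrix.unitaryGroup (Fin 2 × F.Basis) ℂ :=
  ⟨rewardMatrix F, by
    rw [Matrix.mem_unitaryGroup_iff', Matrix.star_eq_conjTranspose, rewardMatrix_conjTranspose,
      rewardMatrix_mul_self]⟩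

/-- The reflection about `|0⟩|0⟩`. -/
def zeroMatrix : Matrix (Fin 2 × F.Basis) (Fin 2 × F.Basis) ℂ :=
  Matrix.diagonal fun p => if p = (0, F.zero) then 1 else -1

theorem zeroMatrix_conjTranspose : (zeroMatrix F)ᴴ = zeroMatrix F := by
  rw [zeroMatrix, Matrix.diagonal_conjTranspose]
  congr 1
  ext p
  simp only [Pi.star_apply]
  split_ifs <;> simp

theorem zeroMatrix_mul_self : zeroMatrix F * zeroMatrix F = 1 := by
  rw [zeroMatrix, Matrix.diagonal_mul_diagonal, ← Matrix.diagonal_one]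
  congr 1
  ext p
  split_ifs <;> simp

/-- The unitary of `zeroMatrix`. -/
def zeroUnitary : Matrix.unitaryGroup (Fin 2 × F.Basis) ℂ :=
  ⟨zeroMatrix F, by
    rw [Matrix.mem_unitaryGroup_iff', Matrix.star_eq_conjTranspose, zeroMatrix_conjTranspose,
      zeroMatrix_mul_self]⟩

variable {F}

theorem zeroMatrix_mulVec (v : Fin 2 × F.Basis → ℂ) :
    zeroMatrix F *ᵥ v = (2 * v (0, F.zero)) • Pi.single (0, F.zero) 1 - v := by
  ext p
  rw [zeroMatrix, Matrix.mulVec_diagonal]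
  by_cases h : p = (0, F.zero)
  · subst h; simp; ring
  · simp [h]

/-- The walk operator. -/
def walkMatrix (O : Matrix.unitaryGroup F.Basis ℂ) :
    Matrix (Fin 2 × F.Basis) (Fin 2 × F.Basis) ℂ :=
  zeroMatrix F * (QProgram.queryMatrix 2 O true * (rewardMatrix F * QProgram.queryMatrix 2 O false))

theorem queryMatrix_true {w : ℕ} (O : Matrix.unitaryGroup F.Basis ℂ) :
    QProgram.queryMatrix w O true = (QProgram.queryMatrix w O false)ᴴ := by
  simp [QProgram.queryMatrix, Matrix.conjTranspose_kronecker]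

theorem queryMatrix_true_mul_false {w : ℕ} (O : Matrix.unitaryGroup F.Basis ℂ) :
    QProgram.queryMatrix w O true * QProgram.queryMatrix w O false = 1 := by
  rw [queryMatrix_true, QProgram.queryMatrix_isometry]

theorem walkMatrix_conjTranspose (O : Matrix.unitaryGroup F.Basis ℂ) :
    (walkMatrix O)ᴴ = QProgram.queryMatrix 2 O true *
      (rewardMatrix F * QProgram.queryMatrix 2 O false) * zeroMatrix F := by
  simp only [walkMatrix, Matrix.conjTranspose_mul, zeroMatrix_conjTranspose, queryMatrix_true,
    Matrix.conjTranspose_conjTranspose, rewardMatrix_conjTranspose, mul_assoc]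

theorem walkMatrix_isometry (O : Matrix.unitaryGroup F.Basis ℂ) :
    (walkMatrix O)ᴴ * walkMatrix O = 1 := by
  have hQ : QProgram.queryMatrix 2 O false * QProgram.queryMatrix 2 O true = 1 :=
    mul_eq_one_comm.mp (queryMatrix_true_mul_false O)
  rw [walkMatrix_conjTranspose, walkMatrix]
  calc _ = QProgram.queryMatrix 2 O true * (rewardMatrix F * (QProgram.queryMatrix 2 O false *
        ((zeroMatrix F * zeroMatrix F) * QProgram.queryMatrix 2 O true) *
          (rewardMatrix F * QProgram.queryMatrix 2 O false))) := by simp only [mul_assoc]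
    _ = QProgram.queryMatrix 2 O true * ((rewardMatrix F * rewardMatrix F) *
          QProgram.queryMatrix 2 O false) := by
        rw [zeroMatrix_mul_self, one_mul, hQ, one_mul, mul_assoc]
    _ = 1 := by rw [rewardMatrix_mul_self, one_mul, queryMatrix_true_mul_false]

theorem queryMatrix_mulVec_single {O : Matrix.unitaryGroup F.Basis ℂ} {R : Reward F}
    (hO : Encodes O R) (p : Fin 2 × F.Basis) :
    (QProgram.queryMatrix 2 O false *ᵥ Pi.single (0, F.zero) 1) p =
      if p.1 = 0 ∧ p.2.2 = R.y p.2.1 then ((√(R.P p.2.1) : ℝ) : ℂ) else 0 := by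
  have h := congrFun hO p.2
  rw [Matrix.mulVec_single_one, Matrix.col_apply] at h
  rw [Matrix.mulVec_single_one, Matrix.col_apply]
  simp only [QProgram.queryMatrix, Matrix.kroneckerMap_apply, Bool.false_eq_true, if_false, h,
    Finset.sum_apply, Matrix.one_apply]
  obtain ⟨q, ω, v⟩ := p
  rw [Finset.sum_eq_single ω]
  · by_cases hq : q = 0 <;> by_cases hv : v = R.y ω <;> simp [hq, hv]
  · intro ω' _ hω
    rw [Pi.single_apply, if_neg]
    intro h'
    exact hω (congrArg Prod.fst h').symm
  · simp

/-- Moving the inverse query to the other side leaves the expectation of the reward reflection in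
the queried state. That state has qubit 0, so only the diagonal entries 1 - 2y enter, with weights
P. -/
theorem single_dotProduct_walk {O : Matrix.unitaryGroup F.Basis ℂ} {R : Reward F}
    (hR : R.BoundedValue) (hO : Encodes O R) :
    ((QProgram.queryMatrix 2 O true * (rewardMatrix F * QProgram.queryMatrix 2 O false)) *ᵥ
      Pi.single (0, F.zero) 1) (0, F.zero) = ((1 - 2 * R.mean : ℝ) : ℂ) := by
  have h0 : ∀ v : Fin 2 × F.Basis → ℂ,
      v (0, F.zero) = star (Pi.single (0, F.zero) 1 : Fin 2 × F.Basis → ℂ) ⬝ᵥ v := by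
    intro v
    simp
  refine (h0 _).trans ?_
  rw [queryMatrix_true, ← Matrix.mulVec_mulVec, Matrix.dotProduct_mulVec,
    ← Matrix.star_mulVec, ← Matrix.mulVec_mulVec]
  set u := QProgram.queryMatrix 2 O false *ᵥ Pi.single (0, F.zero) 1 with hu
  have hu' := queryMatrix_mulVec_single hO
  rw [← hu] at hu'
  have hH : ∀ ω, (rewardMatrix F *ᵥ u) (0, (ω, R.y ω)) =
      ((1 - 2 * clamp (R.y ω) : ℝ) : ℂ) * ((√(R.P ω) : ℝ) : ℂ) := by
    intro ω
    simp only [Matrix.mulVec, dotProduct]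
    rw [Finset.sum_eq_single (0, (ω, R.y ω))]
    · rw [hu']
      simp [rewardMatrix, Matrix.blockDiagonal_apply, qubitReflection]
    · rintro ⟨q, b⟩ _ hb
      rw [hu']
      by_cases hq : q = 0
      · subst hq
        rw [rewardMatrix, Matrix.blockDiagonal_apply, if_neg, zero_mul]
        rintro h
        exact hb (by simp only at h; rw [h])
      · simp [hq]
    · simp
  simp only [dotProduct, Pi.star_apply, Fintype.sum_prod_type, Fin.sum_univ_two]
  have h1 : ∀ ω v, u (1, (ω, v)) = 0 := by intro ω v; rw [hu']; simp
  simp only [h1, star_zero, zero_mul, Finset.sum_const_zero, add_zero]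
  have h2 : ∀ ω, ∑ v, star (u (0, (ω, v))) * (rewardMatrix F *ᵥ u) (0, (ω, v)) =
      ((R.P ω - 2 * (R.P ω * (R.y ω : ℝ)) : ℝ) : ℂ) := by
    intro ω
    rw [Finset.sum_eq_single (R.y ω)]
    · rw [hH, hu']
      simp only [and_self, if_true, RCLike.star_def, Complex.conj_ofReal]
      norm_cast
      have hP := Real.mul_self_sqrt (R.P_nonneg ω)
      -- Off the support the reward may lie outside [0,1] and be truncated, but its weight is zero.
      by_cases hω : R.P ω = 0
      · simp [hω]
      · rw [clamp_of_mem (hR ω hω)]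
        linear_combination (1 - 2 * (R.y ω : ℝ)) * hP
    · intro v _ hv
      rw [hu']
      simp [hv]
    · simp
  simp only [h2]
  norm_cast
  rw [Finset.sum_sub_distrib, R.P_sum, ← Finset.mul_sum, Reward.mean]

/-- With S = 2ee† - 1 and G = S W one has G e = 2⟨e, W e⟩e - W e and G† e = W e, whose sum is a
multiple of e. -/
theorem walkMatrix_moments {O : Matrix.unitaryGroup F.Basis ℂ} {R : Reward F}
    (hR : R.BoundedValue) (hO : Encodes O R) {α : ℝ} (hα : Real.cos α = 1 - 2 * R.mean)
    {M : ℕ} (d : Fin M → ℂ) :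
    QProgram.normSq (∑ m : Fin M, d m • ((walkMatrix O ^ (m : ℕ)) *ᵥ Pi.single (0, F.zero) 1)) =
      (‖∑ m : Fin M, d m * Complex.exp (α * Complex.I) ^ (m : ℕ)‖ ^ 2 +
        ‖∑ m : Fin M, d m * Complex.exp (-α * Complex.I) ^ (m : ℕ)‖ ^ 2) / 2 := by
  have h := single_dotProduct_walk hR hO
  have h0 : ∀ v : Fin 2 × F.Basis → ℂ,
      star (Pi.single (0, F.zero) 1 : Fin 2 × F.Basis → ℂ) ⬝ᵥ v = v (0, F.zero) := by
    intro v
    simp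
  refine normSq_sum_pow_mulVec (walkMatrix_isometry O) (by simp) ?_ ?_ d
  · rw [h0, walkMatrix, ← Matrix.mulVec_mulVec, zeroMatrix_mulVec]
    simp only [Pi.sub_apply, Pi.smul_apply, Pi.single_eq_same, h, hα, smul_eq_mul]
    push_cast
    ring
  · rw [walkMatrix_conjTranspose, walkMatrix, ← Matrix.mulVec_mulVec, zeroMatrix_mulVec, h,
      ← Matrix.mulVec_mulVec _ _ (zeroMatrix F), zeroMatrix_mulVec, Pi.single_eq_same, hα]
    rw [show ((2 : ℂ) * 1) • (Pi.single (0, F.zero) 1 : Fin 2 × F.Basis → ℂ) -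
      Pi.single (0, F.zero) 1 = Pi.single (0, F.zero) 1 by module]
    push_cast
    simp

/-! ### Fourier measurement -/

/-- The primitive root of unity `exp (2 π i / N)`. -/
def zeta (N : ℕ) : ℂ := Complex.exp (2 * Real.pi * Complex.I / N)

theorem zeta_primitive {N : ℕ} (hN : N ≠ 0) : IsPrimitiveRoot (zeta N) N :=
  Complex.isPrimitiveRoot_exp N hN

theorem norm_zeta (N : ℕ) : ‖zeta N‖ = 1 := by
  rw [zeta, show 2 * (Real.pi : ℂ) * Complex.I / N = ((2 * Real.pi / N : ℝ) : ℂ) * Complex.I by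
    push_cast; ring, Complex.norm_exp_ofReal_mul_I]

theorem star_mul_self_of_norm {z : ℂ} (hz : ‖z‖ = 1) : star z * z = 1 := by
  rw [RCLike.star_def, Complex.conj_mul', hz]
  norm_num

theorem sum_zeta_pow {N : ℕ} {m m' : ℕ} (hm : m < N) (hm' : m' < N) :
    ∑ j : Fin N, star ((star (zeta N ^ (j : ℕ))) ^ m) * (star (zeta N ^ (j : ℕ))) ^ m' =
      if m = m' then (N : ℂ) else 0 := by
  have hN : N ≠ 0 := by omega
  have hz := zeta_primitive hN
  have hs := star_mul_self_of_norm (norm_zeta N)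
  set ξ := zeta N ^ m * star (zeta N) ^ m' with hξ
  have h1 : ∀ j : Fin N, star ((star (zeta N ^ (j : ℕ))) ^ m) * (star (zeta N ^ (j : ℕ))) ^ m' =
      ξ ^ (j : ℕ) := by
    intro j
    simp only [star_pow, star_star, hξ, mul_pow, ← pow_mul]
    ring
  simp only [h1]
  rw [Fin.sum_univ_eq_sum_range (fun j => ξ ^ j) N]
  split_ifs with h
  · have : ξ = 1 := by rw [hξ, h, ← mul_pow, mul_comm, hs, one_pow]
    simp [this]
  · have hne : ξ ≠ 1 := by
      intro h2
      apply h
      apply hz.pow_inj hm hm'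
      calc zeta N ^ m = zeta N ^ m * (star (zeta N) * zeta N) ^ m' := by rw [hs]; simp
        _ = ξ * zeta N ^ m' := by rw [mul_pow, hξ]; ring
        _ = _ := by rw [h2, one_mul]
    have hN1 : ξ ^ N = 1 := by
      rw [hξ, mul_pow, ← pow_mul, ← pow_mul, mul_comm m, mul_comm m', pow_mul, pow_mul, ← star_pow,
        hz.pow_eq_one]
      simp
    rw [geom_sum_eq hne, hN1]
    simp

/-- Parseval's identity on the roots of unity. -/
theorem parseval {N M : ℕ} (hM : M ≤ N) (c : Fin M → ℂ) {a : ℂ} (ha : ‖a‖ = 1) :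
    ∑ j : Fin N, ‖∑ m : Fin M, c m * (star (zeta N ^ (j : ℕ)) * a) ^ (m : ℕ)‖ ^ 2 =
      N * ∑ m, ‖c m‖ ^ 2 := by
  have hcast : ∀ z : ℂ, ((‖z‖ ^ 2 : ℝ) : ℂ) = star z * z := by
    intro z
    rw [RCLike.star_def, Complex.conj_mul']
    push_cast; rfl
  have key : ((∑ j : Fin N, ‖∑ m : Fin M, c m * (star (zeta N ^ (j : ℕ)) * a) ^ (m : ℕ)‖ ^ 2 : ℝ)
      : ℂ) = ((N * ∑ m, ‖c m‖ ^ 2 : ℝ) : ℂ) := by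
    rw [Complex.ofReal_sum, Complex.ofReal_mul, Complex.ofReal_sum]
    simp only [hcast, star_sum, Finset.sum_mul, Finset.mul_sum]
    rw [Finset.sum_comm]
    refine Finset.sum_congr rfl fun m _ => ?_
    rw [Finset.sum_comm, Finset.sum_eq_single m]
    · have h := sum_zeta_pow (m.2.trans_le hM) (m.2.trans_le hM)
      rw [if_pos rfl] at h
      calc _ = ∑ j : Fin N, (star (c m) * c m * (star a * a) ^ (m : ℕ)) *
            (star ((star (zeta N ^ (j : ℕ))) ^ (m : ℕ)) *
              (star (zeta N ^ (j : ℕ))) ^ (m : ℕ)) := by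
            refine Finset.sum_congr rfl fun j _ => ?_
            simp only [star_mul', star_pow, mul_pow]
            ring
        _ = _ := by
          rw [← Finset.mul_sum, h, star_mul_self_of_norm ha]
          push_cast
          ring
    · intro m' _ hne
      have h := sum_zeta_pow (m'.2.trans_le hM) (m.2.trans_le hM)
      rw [if_neg (fun h => hne (Fin.ext h))] at h
      calc _ = ∑ j : Fin N, (star (c m') * c m * (star a ^ (m' : ℕ) * a ^ (m : ℕ))) *
            (star ((star (zeta N ^ (j : ℕ))) ^ (m' : ℕ)) *
              (star (zeta N ^ (j : ℕ))) ^ (m : ℕ)) := by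
            refine Finset.sum_congr rfl fun j _ => ?_
            simp only [star_mul', star_pow, mul_pow]
            ring
        _ = _ := by rw [← Finset.mul_sum, h, mul_zero]
    · simp
  exact_mod_cast key

/-- The Kraus operators of the Fourier measurement of the counter. -/
def fourierKraus (M N : ℕ) (j : Fin N) : Matrix (Fin (M + 1)) (Fin (M + 1)) ℂ :=
  Matrix.of fun m m' => if m = 0 then
    (((√N)⁻¹ : ℝ) : ℂ) * (star (zeta N ^ (j : ℕ))) ^ (m' : ℕ) else 0

/-- The N Fourier vectors form a tight frame of the counter space. N may exceed the dimension, which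
refines the grid of outcomes at no cost in queries. -/
theorem sum_fourierKraus {M N : ℕ} (hM : M < N) :
    ∑ j, (fourierKraus M N j)ᴴ * fourierKraus M N j = 1 := by
  have hN : (N : ℝ) ≠ 0 := by
    have : 0 < N := by omega
    positivity
  have hsq : (((√N)⁻¹ : ℝ) : ℂ) * (((√N)⁻¹ : ℝ) : ℂ) * N = 1 := by
    norm_cast
    rw [← mul_inv, Real.mul_self_sqrt (Nat.cast_nonneg N), inv_mul_cancel₀ hN]
  ext m m'
  rw [Matrix.sum_apply]
  have h1 : ∀ j, ((fourierKraus M N j)ᴴ * fourierKraus M N j) m m' =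
      (((√N)⁻¹ : ℝ) : ℂ) * (((√N)⁻¹ : ℝ) : ℂ) *
        (star ((star (zeta N ^ (j : ℕ))) ^ (m : ℕ)) * (star (zeta N ^ (j : ℕ))) ^ (m' : ℕ)) := by
    intro j
    rw [Matrix.mul_apply, Finset.sum_eq_single 0]
    · simp only [fourierKraus, Matrix.conjTranspose_apply, Matrix.of_apply, if_true, star_mul',
        RCLike.star_def, Complex.conj_ofReal]
      ring
    · intro b _ hb
      simp [fourierKraus, hb]
    · simp
  simp only [h1]
  rw [← Finset.mul_sum, sum_zeta_pow (by omega) (by omega), Matrix.one_apply]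
  by_cases h : m = m'
  · rw [if_pos (by rw [h]), if_pos h, hsq]
  · rw [if_neg (fun h' => h (Fin.ext h')), if_neg h, mul_zero]

/-- The Kraus operators that reset the counter to the state `c`. -/
def resetKraus {M : ℕ} (c : Fin (M + 1) → ℂ) (i : Fin (M + 1)) :
    Matrix (Fin (M + 1)) (Fin (M + 1)) ℂ :=
  Matrix.of fun m m' => if m' = i then c m else 0

/-- Preparing the window by a measurement avoids extending c to a unitary. From counter value 0,
only outcome 0 has positive probability. -/
theorem sum_resetKraus {M : ℕ} {c : Fin (M + 1) → ℂ} (hc : ∑ m, ‖c m‖ ^ 2 = 1) :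
    ∑ i, (resetKraus c i)ᴴ * resetKraus c i = 1 := by
  have hc' : ∑ m, star (c m) * c m = 1 := by
    simp only [RCLike.star_def, Complex.conj_mul']
    exact_mod_cast hc
  ext m m'
  simp only [Matrix.sum_apply, Matrix.mul_apply, resetKraus, Matrix.conjTranspose_apply,
    Matrix.of_apply, Matrix.one_apply]
  rw [Finset.sum_eq_single m]
  · by_cases h : m = m'
    · subst h
      simpa using hc'
    · simp [h, Ne.symm h]
  · intro i _ hi
    simp [hi.symm]
  · simp

theorem single_eq_blockVec {B : Type} [DecidableEq B] {M : ℕ} (b : B) :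
    (Pi.single (0, b) 1 : Fin (2 * M + 1 + 1) × B → ℂ) =
      blockVec (Pi.single 0 (Pi.single (0, b) 1)) := by
  ext p
  unfold blockVec
  have hp : p = (0, b) ↔ counterEquiv B M p = (0, (0, b)) := by
    rw [← counterEquiv_zero, (counterEquiv B M).injective.eq_iff]
  by_cases h : p = (0, b)
  · rw [hp.1 h, h]
    simp
  · have h' := mt hp.2 h
    rw [Pi.single_apply, if_neg h]
    by_cases h1 : (counterEquiv B M p).1 = 0
    · rw [h1, Pi.single_eq_same, Pi.single_apply, if_neg]
      exact fun h2 => h' (Prod.ext h1 h2)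
    · rw [Pi.single_eq_of_ne h1, Pi.zero_apply]

/-- Phase estimation for the walk, with counter state `c` and a Fourier measurement with `N`
outcomes, the `j`-th of which leads to the output `out j`. -/
def phaseEstimation (F : Format) (M N : ℕ) (hM : M < N) (c : Fin (M + 1) → ℂ)
    (hc : ∑ m, ‖c m‖ ^ 2 = 1) (out : Fin N → ℝ) : QAlgorithm F where
  w := 2 * M + 1
  program := .measure (M + 1) (fun i => onCounter F.Basis (resetKraus c i))
    (sum_onCounter _ (sum_resetKraus hc)) fun _ =>
      walkLoop (rewardUnitary F) (zeroUnitary F)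
        (.measure N (fun j => onCounter F.Basis (fourierKraus M N j))
          (sum_onCounter _ (sum_fourierKraus hM)) fun j => .output (out j)) M 0

theorem queries_phaseEstimation (F : Format) {M N : ℕ} (hM : M < N) {c : Fin (M + 1) → ℂ}
    (hc : ∑ m, ‖c m‖ ^ 2 = 1) (out : Fin N → ℝ) :
    (phaseEstimation F M N hM c hc out).program.queries = 2 * M := by
  have : (Finset.univ.sup fun _ : Fin N => 0) = 0 := Finset.sup_eq_bot_iff _ _ |>.2 (by simp)
  simp [phaseEstimation, QProgram.queries, queries_walkLoop,
    Finset.sup_const Finset.univ_nonempty]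

/-- Probability of the `j`-th outcome of the phase estimation. -/
def outcomeProb (N : ℕ) {M : ℕ} (c : Fin M → ℂ) (α : ℝ) (j : Fin N) : ℝ :=
  (2 * N : ℝ)⁻¹ *
    (‖∑ m : Fin M, c m * (star (zeta N ^ (j : ℕ)) * Complex.exp (α * Complex.I)) ^ (m : ℕ)‖ ^ 2 +
      ‖∑ m : Fin M, c m * (star (zeta N ^ (j : ℕ)) * Complex.exp (-α * Complex.I)) ^ (m : ℕ)‖ ^ 2)

theorem outcomeProb_nonneg {N M : ℕ} (c : Fin M → ℂ) (α : ℝ) (j : Fin N) :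
    0 ≤ outcomeProb N c α j := by
  unfold outcomeProb
  positivity

theorem sum_outcomeProb {N M : ℕ} (hM : M ≤ N) (hN : N ≠ 0) (c : Fin M → ℂ) (α : ℝ) :
    ∑ j, outcomeProb N c α j = ∑ m, ‖c m‖ ^ 2 := by
  unfold outcomeProb
  have h2 : ‖Complex.exp (-α * Complex.I)‖ = 1 := by
    rw [← Complex.ofReal_neg, Complex.norm_exp_ofReal_mul_I]
  rw [← Finset.mul_sum, Finset.sum_add_distrib, parseval hM c (Complex.norm_exp_ofReal_mul_I α),
    parseval hM c h2]
  field_simp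
  ring

theorem law_phaseEstimation {F : Format} {M N : ℕ} (hM : M < N) {c : Fin (M + 1) → ℂ}
    (hc : ∑ m, ‖c m‖ ^ 2 = 1) (out : Fin N → ℝ) {O : Matrix.unitaryGroup F.Basis ℂ} {R : Reward F}
    (hR : R.BoundedValue) (hO : Encodes O R) {α : ℝ} (hα : Real.cos α = 1 - 2 * R.mean) (x : ℝ) :
    (phaseEstimation F M N hM c hc out).law O x =
      ∑ j, (Pi.single (out j) (ENNReal.ofReal (outcomeProb N c α j)) : ℝ → ENNReal) x := by
  change (phaseEstimation F M N hM c hc out).program.weight O _ x = _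
  have hstart : (phaseEstimation F M N hM c hc out).start =
      blockVec (M := M) (Pi.single 0 (Pi.single (0, F.zero) 1)) := single_eq_blockVec F.zero
  rw [hstart]
  simp only [phaseEstimation, QProgram.weight, onCounter_mulVec]
  rw [Finset.sum_eq_single 0]
  · have h0 : (fun m => ∑ m', resetKraus c 0 m m' •
        (Pi.single 0 (Pi.single (0, F.zero) 1) : Fin (M + 1) → Fin 2 × F.Basis → ℂ) m') =
        fun m => c m • ((walkMatrix O ^ min (m : ℕ) 0) *ᵥ Pi.single (0, F.zero) 1) := by
      ext1 m
      rw [Finset.sum_eq_single 0]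
      · simp only [resetKraus, Matrix.of_apply, if_true, Pi.single_eq_same, Nat.min_zero,
          pow_zero, Matrix.one_mulVec]
      · intro m' _ hm'
        simp [resetKraus, hm']
      · simp
    rw [h0, weight_walkLoop O (rewardUnitary F) (zeroUnitary F) _ _ _ (walkMatrix O) rfl]
    simp only [QProgram.weight, onCounter_mulVec, normSq_blockVec]
    refine Finset.sum_congr rfl fun j _ => ?_
    congr 3
    rw [Finset.sum_eq_single 0]
    · have hmin : ∀ m : Fin (M + 1), min (m : ℕ) (0 + M) = m := fun m => by omega
      simp only [hmin, fourierKraus, Matrix.of_apply, if_true, smul_smul]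
      rw [walkMatrix_moments hR hO hα, outcomeProb]
      have h3 : ∀ a : ℂ, ‖∑ m : Fin (M + 1), (((√N)⁻¹ : ℝ) : ℂ) *
          (star (zeta N ^ (j : ℕ))) ^ (m : ℕ) * c m * a ^ (m : ℕ)‖ ^ 2 = (N : ℝ)⁻¹ *
          ‖∑ m : Fin (M + 1), c m * (star (zeta N ^ (j : ℕ)) * a) ^ (m : ℕ)‖ ^ 2 := by
        intro a
        rw [← Real.sq_sqrt (Nat.cast_nonneg N), ← inv_pow, Real.sqrt_sq (Real.sqrt_nonneg _),
          ← abs_of_nonneg (inv_nonneg.2 (Real.sqrt_nonneg (N : ℝ))), ← Real.norm_eq_abs,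
          ← Complex.norm_real, ← mul_pow, ← norm_mul, Finset.mul_sum]
        congr 3
        ext m
        rw [Complex.norm_real, Real.norm_eq_abs,
          abs_of_nonneg (inv_nonneg.2 (Real.sqrt_nonneg (N : ℝ))), mul_pow]
        ring
      rw [h3, h3, mul_inv]
      ring
    · intro m _ hm
      simp [fourierKraus, hm, QProgram.normSq]
    · simp
  · intro i _ hi
    have h0 : (fun m => ∑ m', resetKraus c i m m' •
        (Pi.single 0 (Pi.single (0, F.zero) 1) : Fin (M + 1) → Fin 2 × F.Basis → ℂ) m') = 0 := by
      ext1 m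
      refine Finset.sum_eq_zero fun m' _ => ?_
      by_cases h : m' = 0
      · subst h
        simp [resetKraus, hi.symm]
      · simp [h]
    rw [h0]
    exact QProgram.weight_zero _ _ _
  · simp

theorem law_phaseEstimation_real {F : Format} {M N : ℕ} (hM : M < N) {c : Fin (M + 1) → ℂ}
    (hc : ∑ m, ‖c m‖ ^ 2 = 1) (out : Fin N → ℝ) {O : Matrix.unitaryGroup F.Basis ℂ} {R : Reward F}
    (hR : R.BoundedValue) (hO : Encodes O R) {α : ℝ} (hα : Real.cos α = 1 - 2 * R.mean)
    {S : Set ℝ} (hS : MeasurableSet S) [DecidablePred (· ∈ S)] :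
    ((phaseEstimation F M N hM c hc out).law O).toMeasure.real S =
      ∑ j with out j ∈ S, outcomeProb N c α j := by
  rw [MeasureTheory.measureReal_def, PMF.toMeasure_apply_eq_toOuterMeasure_apply _ hS,
    PMF.toOuterMeasure_apply]
  have h : ∀ x, S.indicator ((phaseEstimation F M N hM c hc out).law O) x =
      ∑ j, if out j ∈ S then
        (Pi.single (out j) (ENNReal.ofReal (outcomeProb N c α j)) : ℝ → ENNReal) x else 0 := by
    intro x
    by_cases hx : x ∈ S
    · rw [Set.indicator_of_mem hx, law_phaseEstimation hM hc out hR hO hα]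
      refine Finset.sum_congr rfl fun j _ => ?_
      split_ifs with hj
      · rfl
      · rw [Pi.single_apply, if_neg]
        rintro rfl
        exact hj hx
    · rw [Set.indicator_of_notMem hx]
      symm
      refine Finset.sum_eq_zero fun j _ => ?_
      split_ifs with hj
      · rw [Pi.single_apply, if_neg]
        rintro rfl
        exact hx hj
      · rfl
  simp only [h]
  rw [Summable.tsum_finsetSum (fun _ _ => ENNReal.summable)]
  have h' : ∀ j, (∑' x, if out j ∈ S then
      (Pi.single (out j) (ENNReal.ofReal (outcomeProb N c α j)) : ℝ → ENNReal) x else 0) =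
      if out j ∈ S then ENNReal.ofReal (outcomeProb N c α j) else 0 := by
    intro j
    split_ifs with hj
    · exact tsum_pi_single _ _
    · simp
  simp only [h']
  rw [← Finset.sum_filter, ← ENNReal.ofReal_sum_of_nonneg fun j _ => outcomeProb_nonneg c α j,
    ENNReal.toReal_ofReal (Finset.sum_nonneg fun j _ => outcomeProb_nonneg c α j)]

/-! ### Quantum Monte Carlo by phase estimation -/

theorem norm_geom_sum_le {y : ℂ} (hy : ‖y‖ = 1) {ε : ℝ} (hε : 0 < ε) (h : 2 * ε ≤ ‖y - 1‖)
    (L : ℕ) : ‖∑ i ∈ Finset.range L, y ^ i‖ ≤ 1 / ε := by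
  have h1 := congrArg norm (geom_sum_mul y L)
  rw [norm_mul] at h1
  have h2 : ‖y ^ L - 1‖ ≤ 2 := by
    calc _ ≤ ‖y ^ L‖ + ‖(1 : ℂ)‖ := norm_sub_le _ _
      _ = 2 := by rw [norm_pow, hy]; norm_num
  rw [le_div_iff₀ hε]
  nlinarith [norm_nonneg (∑ i ∈ Finset.range L, y ^ i)]

/-- All phases stay within one radian, so each term has real part at least 1 - 1/2. -/
theorem le_norm_geom_sum {β : ℝ} {L : ℕ} (hβ : |β| * L ≤ 1) :
    (L : ℝ) / 2 ≤ ‖∑ i ∈ Finset.range L, Complex.exp (β * Complex.I) ^ i‖ := by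
  refine le_trans ?_ (Complex.re_le_norm _)
  rw [Complex.re_sum]
  have h : ∀ i ∈ Finset.range L, (1 : ℝ) / 2 ≤ (Complex.exp (β * Complex.I) ^ i).re := by
    intro i hi
    rw [← Complex.exp_nat_mul, ← mul_assoc, ← Complex.ofReal_natCast, ← Complex.ofReal_mul,
      Complex.exp_ofReal_mul_I_re]
    have h1 : |(i : ℝ) * β| ≤ 1 := by
      rw [abs_mul, Nat.abs_cast]
      have : (i : ℝ) ≤ L := by exact_mod_cast (Finset.mem_range.1 hi).le
      nlinarith [abs_nonneg β]
    have h2 := Real.one_sub_sq_div_two_le_cos (x := (i : ℝ) * β)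
    have h3 : ((i : ℝ) * β) ^ 2 ≤ 1 := by rw [← sq_abs]; nlinarith [abs_nonneg ((i : ℝ) * β)]
    linarith
  have := Finset.card_nsmul_le_sum _ _ _ h
  simp at this
  linarith

/-- The estimate of the mean that belongs to the `j`-th outcome. -/
def phaseOutput (N : ℕ) (j : Fin N) : ℝ := (1 - (zeta N ^ (j : ℕ)).re) / 2

/-- The error is half the difference of two real parts. Only Re a matters, so the sign ambiguity of
the phase ±α is harmless. -/
theorem abs_phaseOutput_sub_le {N : ℕ} (j : Fin N) {α μ : ℝ} (hα : Real.cos α = 1 - 2 * μ) {a : ℂ}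
    (hre : a.re = Real.cos α) :
    2 * |phaseOutput N j - μ| ≤ ‖star (zeta N ^ (j : ℕ)) * a - 1‖ := by
  have hz : ‖zeta N ^ (j : ℕ)‖ = 1 := by rw [norm_pow, norm_zeta, one_pow]
  have h1 : ‖star (zeta N ^ (j : ℕ)) * a - 1‖ = ‖a - zeta N ^ (j : ℕ)‖ := by
    rw [← star_mul_self_of_norm hz, ← mul_sub, norm_mul, norm_star, hz, one_mul]
  rw [h1]
  refine le_trans (le_of_eq ?_) (Complex.abs_re_le_norm _)
  rw [Complex.sub_re, hre, hα, ← abs_two, ← abs_mul, phaseOutput]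
  congr 1
  ring

theorem exists_arccos {F : Format} {R : Reward F} (hR : R.BoundedValue) :
    ∃ α : ℝ, 0 ≤ α ∧ α ≤ Real.pi ∧ Real.cos α = 1 - 2 * R.mean := by
  have h0 : 0 ≤ R.mean := Finset.sum_nonneg fun ω _ => by
    by_cases h : R.P ω = 0
    · simp [h]
    · exact mul_nonneg (R.P_nonneg ω) (hR ω h).1
  have h1 : R.mean ≤ 1 := by
    rw [← R.P_sum]
    refine Finset.sum_le_sum fun ω _ => ?_
    by_cases h : R.P ω = 0
    · simp [h]
    · exact mul_le_of_le_one_right (R.P_nonneg ω) (hR ω h).2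
  exact ⟨Real.arccos (1 - 2 * R.mean), Real.arccos_nonneg _, Real.arccos_le_pi _,
    Real.cos_arccos (by linarith) (by linarith)⟩

open Polynomial in
/-- The counter state whose generating polynomial is proportional to the `k`-th power of the
Dirichlet kernel. -/
theorem exists_window (L l : ℕ) : ∃ c : Fin ((l + 1) * L + 1) → ℂ, ∑ m, ‖c m‖ ^ 2 = 1 ∧
    ∀ y : ℂ, ‖∑ m, c m * y ^ (m : ℕ)‖ ^ 2 * ((L : ℝ) + 1) ^ (2 * l + 1) ≤
      (l + 1) * ‖∑ i ∈ Finset.range (L + 1), y ^ i‖ ^ (2 * (l + 1)) := by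
  set P : ℂ[X] := (∑ i ∈ Finset.range (L + 1), X ^ i) ^ (l + 1) with hP
  have hdeg : P.natDegree < (l + 1) * L + 1 := by
    refine Nat.lt_succ_of_le (natDegree_pow_le_of_le _ ?_)
    refine natDegree_sum_le_of_forall_le _ _ fun i hi => ?_
    rw [natDegree_X_pow]
    exact Nat.lt_succ_iff.1 (Finset.mem_range.1 hi)
  have heval : ∀ y : ℂ, ∑ m : Fin ((l + 1) * L + 1), P.coeff m * y ^ (m : ℕ) =
      (∑ i ∈ Finset.range (L + 1), y ^ i) ^ (l + 1) := by
    intro y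
    rw [Fin.sum_univ_eq_sum_range (fun m => P.coeff m * y ^ m), ← eval_eq_sum_range' hdeg, hP,
      eval_pow, eval_finsetSum]
    simp
  set Z : ℝ := ∑ m : Fin ((l + 1) * L + 1), ‖P.coeff m‖ ^ 2 with hZ
  have hZL : ((L : ℝ) + 1) ^ (2 * l + 1) ≤ (l + 1) * Z := by
    -- Lower bound for the normalization Z: evaluate P at 1, then apply Cauchy–Schwarz over the at
    -- most (l + 1)(L + 1) coefficients.
    have h1 : ((L : ℝ) + 1) ^ (l + 1) ≤ ∑ m : Fin ((l + 1) * L + 1), ‖P.coeff m‖ := by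
      have h := heval 1
      simp only [one_pow, mul_one, Finset.sum_const, Finset.card_range, nsmul_eq_mul] at h
      calc ((L : ℝ) + 1) ^ (l + 1) = ‖∑ m : Fin ((l + 1) * L + 1), P.coeff m‖ := by
            rw [h, norm_pow, Complex.norm_natCast]
            push_cast; rfl
        _ ≤ _ := norm_sum_le _ _
    have h2 := sq_sum_le_card_mul_sum_sq (s := Finset.univ)
      (f := fun m : Fin ((l + 1) * L + 1) => ‖P.coeff m‖)
    rw [Finset.card_univ, Fintype.card_fin, ← hZ] at h2
    have h3 : (((l + 1) * L + 1 : ℕ) : ℝ) ≤ (l + 1) * (L + 1) := by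
      push_cast
      nlinarith [Nat.cast_nonneg (α := ℝ) l]
    have hZ0 : 0 ≤ Z := Finset.sum_nonneg fun _ _ => by positivity
    have hL : (0 : ℝ) < (L : ℝ) + 1 := by positivity
    have h4 : ((L : ℝ) + 1) ^ (2 * l + 1) * (L + 1) ≤ ((l + 1) * Z) * (L + 1) := by
      calc ((L : ℝ) + 1) ^ (2 * l + 1) * (L + 1) = (((L : ℝ) + 1) ^ (l + 1)) ^ 2 := by ring
        _ ≤ (∑ m : Fin ((l + 1) * L + 1), ‖P.coeff m‖) ^ 2 := by gcongr
        _ ≤ _ := h2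
        _ ≤ ((l + 1) * (L + 1)) * Z := by gcongr
        _ = _ := by ring
    exact le_of_mul_le_mul_right h4 hL
  have hZpos : 0 < Z := by
    have : (0 : ℝ) < ((L : ℝ) + 1) ^ (2 * l + 1) := by positivity
    have h := this.trans_le hZL
    exact pos_of_mul_pos_right h (by positivity)
  have hs : (√Z)⁻¹ ^ 2 = Z⁻¹ := by rw [inv_pow, Real.sq_sqrt hZpos.le]
  refine ⟨fun m => (((√Z)⁻¹ : ℝ) : ℂ) * P.coeff m, ?_, fun y => ?_⟩
  · simp only [norm_mul, mul_pow, Complex.norm_real, Real.norm_eq_abs, sq_abs, hs]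
    rw [← Finset.mul_sum, ← hZ, inv_mul_cancel₀ hZpos.ne']
  · simp only [mul_assoc]
    rw [← Finset.mul_sum, heval, norm_mul, mul_pow, Complex.norm_real, Real.norm_eq_abs, sq_abs, hs,
      norm_pow, ← pow_mul, mul_comm (l + 1) 2, mul_comm _ (_ ^ (2 * l + 1)), ← mul_assoc]
    refine mul_le_mul_of_nonneg_right ?_ (by positivity)
    rw [← div_eq_mul_inv, div_le_iff₀ hZpos]
    exact hZL

/-- Of the 2l + 2 kernel factors, 2l are bounded by 1/ε away from the peak. The remaining square is
the unnormalized outcome distribution of the flat window, whose sum is known from Parseval. -/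
theorem sum_outcomeProb_le {L l N : ℕ} (hN : (l + 1) * L < N) {c : Fin ((l + 1) * L + 1) → ℂ}
    (hc : ∀ y : ℂ, ‖∑ m, c m * y ^ (m : ℕ)‖ ^ 2 * ((L : ℝ) + 1) ^ (2 * l + 1) ≤
      (l + 1) * ‖∑ i ∈ Finset.range (L + 1), y ^ i‖ ^ (2 * (l + 1)))
    {ε : ℝ} (hε : 0 < ε) (α : ℝ) (s : Finset (Fin N))
    (h1 : ∀ j ∈ s, 2 * ε ≤ ‖star (zeta N ^ (j : ℕ)) * Complex.exp (α * Complex.I) - 1‖)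
    (h2 : ∀ j ∈ s, 2 * ε ≤ ‖star (zeta N ^ (j : ℕ)) * Complex.exp (-α * Complex.I) - 1‖) :
    ∑ j ∈ s, outcomeProb N c α j ≤ (l + 1) / ((L + 1) * ε) ^ (2 * l) := by
  have hL : (0 : ℝ) < (L : ℝ) + 1 := by positivity
  have hN0 : (0 : ℝ) < N := by
    have : 0 < N := by omega
    positivity
  have hLN : L + 1 ≤ N := by
    have : L ≤ (l + 1) * L := Nat.le_mul_of_pos_left L (by omega)
    omega
  have hterm : ∀ y : ℂ, ‖y‖ = 1 → 2 * ε ≤ ‖y - 1‖ → ‖∑ m, c m * y ^ (m : ℕ)‖ ^ 2 ≤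
      (l + 1) / ((L + 1) * ε) ^ (2 * l) / (L + 1) *
        ‖∑ m : Fin (L + 1), (1 : ℂ) * y ^ (m : ℕ)‖ ^ 2 := by
    intro y hy hy2
    have hg := norm_geom_sum_le hy hε hy2 (L + 1)
    simp only [one_mul]
    rw [Fin.sum_univ_eq_sum_range (fun i => y ^ i)]
    set D := ‖∑ i ∈ Finset.range (L + 1), y ^ i‖ with hD
    have hpow : D ^ (2 * (l + 1)) ≤ (1 / ε) ^ (2 * l) * D ^ 2 := by
      rw [show 2 * (l + 1) = 2 * l + 2 by ring, pow_add]
      gcongr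
    have h3 := (hc y).trans (mul_le_mul_of_nonneg_left hpow (by positivity : (0 : ℝ) ≤ l + 1))
    rw [← le_div_iff₀ (by positivity)] at h3
    refine h3.trans (le_of_eq ?_)
    rw [mul_pow, one_div, inv_pow]
    field_simp
    ring
  set K : ℝ := (l + 1) / ((L + 1) * ε) ^ (2 * l) with hK
  have hn1 := Complex.norm_exp_ofReal_mul_I α
  have hn2 : ‖Complex.exp (-α * Complex.I)‖ = 1 := by
    rw [← Complex.ofReal_neg, Complex.norm_exp_ofReal_mul_I]
  have hz : ∀ (j : Fin N) (a : ℂ), ‖a‖ = 1 → ‖star (zeta N ^ (j : ℕ)) * a‖ = 1 := by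
    intro j a ha
    rw [norm_mul, norm_star, norm_pow, norm_zeta, ha]
    simp
  have hle : ∀ j ∈ s, outcomeProb N c α j ≤
      K / (L + 1) * outcomeProb N (fun _ : Fin (L + 1) => (1 : ℂ)) α j := by
    intro j hj
    unfold outcomeProb
    rw [mul_left_comm, mul_add (K / _)]
    gcongr
    · exact hterm _ (hz j _ hn1) (h1 j hj)
    · exact hterm _ (hz j _ hn2) (h2 j hj)
  calc ∑ j ∈ s, outcomeProb N c α j ≤
        ∑ j ∈ s, K / (L + 1) * outcomeProb N (fun _ : Fin (L + 1) => (1 : ℂ)) α j :=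
        Finset.sum_le_sum hle
    _ ≤ ∑ j, K / (L + 1) * outcomeProb N (fun _ : Fin (L + 1) => (1 : ℂ)) α j :=
        Finset.sum_le_sum_of_subset_of_nonneg (Finset.subset_univ s) fun j _ _ =>
          mul_nonneg (by positivity) (outcomeProb_nonneg _ _ _)
    _ = K := by
        rw [← Finset.mul_sum, sum_outcomeProb hLN (by omega)]
        simp
        field_simp

/-! ### Choice of parameters in three ranges of ε and δ -/

theorem measurableSet_error (ε μ : ℝ) : MeasurableSet {x : ℝ | ε ≤ |x - μ|} :=
  measurableSet_le measurable_const (by fun_prop)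

theorem exists_qmc_of_small_delta (F : Format) {ε δ : ℝ} (hε : 0 < ε) (hδ : 0 < δ)
    (hl : 1 / 100 ≤ Real.log (1 / δ)) : ∃ A : QAlgorithm F,
    (A.program.queries : ℝ) ≤ 2000 / ε * Real.log (1 / δ) ∧
    ∀ (R : Reward F) (O : Matrix.unitaryGroup F.Basis ℂ), R.BoundedValue → Encodes O R →
      (A.law O).toMeasure.real {x | ε ≤ |x - R.mean|} ≤ δ := by
  classical
  set lam := Real.log (1 / δ) with hlam
  -- With (L + 1)ε ≥ 3 the tail is at most (l + 1)/9^l ≤ 3^(-l) ≤ exp(-lam) = δ. The 2(l + 1)L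
  -- queries fit the budget because lam ≥ 1/100 absorbs the additive constant.
  set l := ⌈lam⌉₊ with hldef
  set L := ⌊3 / ε⌋₊ with hLdef
  obtain ⟨c, hc1, hc2⟩ := exists_window L l
  refine ⟨phaseEstimation F ((l + 1) * L) ((l + 1) * L + 1) (Nat.lt_succ_self _) c hc1
    (phaseOutput _), ?_, ?_⟩
  · rw [queries_phaseEstimation]
    have h1 : (l : ℝ) ≤ lam + 1 := (Nat.ceil_lt_add_one (by linarith)).le
    have h2 : (L : ℝ) ≤ 3 / ε := Nat.floor_le (by positivity)
    push_cast
    calc 2 * (((l : ℝ) + 1) * L) ≤ 2 * ((lam + 1 + 1) * (3 / ε)) := by gcongr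
      _ = (6 * lam + 12) / ε := by ring
      _ ≤ (2000 * lam) / ε := by gcongr; linarith
      _ = _ := by ring
  · intro R O hR hO
    obtain ⟨α, -, -, hα⟩ := exists_arccos hR
    rw [law_phaseEstimation_real (Nat.lt_succ_self _) hc1 _ hR hO hα (measurableSet_error _ _)]
    have hre2 : (Complex.exp (-α * Complex.I)).re = Real.cos α := by
      rw [← Complex.ofReal_neg, Complex.exp_ofReal_mul_I_re, Real.cos_neg]
    have h := sum_outcomeProb_le (N := (l + 1) * L + 1) (Nat.lt_succ_self _) hc2 hε α
      {j | phaseOutput _ j ∈ {x | ε ≤ |x - R.mean|}}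
      (fun j hj => by
        have h1 : ε ≤ |phaseOutput _ j - R.mean| := (Finset.mem_filter.1 hj).2
        have h2 := abs_phaseOutput_sub_le j hα
          (Complex.exp_ofReal_mul_I_re α)
        linarith)
      (fun j hj => by
        have h1 : ε ≤ |phaseOutput _ j - R.mean| := (Finset.mem_filter.1 hj).2
        have h2 := abs_phaseOutput_sub_le j hα hre2
        linarith)
    refine h.trans ?_
    have h3 : 3 ≤ ((L : ℝ) + 1) * ε := by
      rw [← div_le_iff₀ hε]
      exact (Nat.lt_floor_add_one _).le
    have h4 : ((l : ℝ) + 1) / (((L : ℝ) + 1) * ε) ^ (2 * l) ≤ (l + 1) / 9 ^ l := by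
      rw [show (9 : ℝ) ^ l = 3 ^ (2 * l) by rw [pow_mul]; norm_num]
      gcongr
    have h5 : ((l : ℝ) + 1) ≤ 2 ^ l := by
      exact_mod_cast Nat.succ_le_of_lt (Nat.lt_two_pow_self (n := l))
    have h6 : ((l : ℝ) + 1) / 9 ^ l ≤ (1 / 3) ^ l := by
      rw [div_le_iff₀ (by positivity), ← mul_pow]
      refine h5.trans ?_
      gcongr
      norm_num
    have h7 : ((1 : ℝ) / 3) ^ l ≤ Real.exp (-lam) := by
      calc ((1 : ℝ) / 3) ^ l ≤ (Real.exp (-1)) ^ l := by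
            gcongr
            rw [Real.exp_neg, one_div]
            exact inv_anti₀ (Real.exp_pos 1) (Real.exp_one_lt_d9.le.trans (by norm_num))
        _ = Real.exp (-l) := by rw [← Real.exp_nat_mul]; ring_nf
        _ ≤ _ := by
          gcongr
          exact Nat.le_ceil _
    have h8 : Real.exp (-lam) = δ := by
      rw [hlam, one_div, Real.log_inv, neg_neg, Real.exp_log hδ]
    linarith

theorem exists_qmc_of_one_le (F : Format) {ε δ : ℝ} (hε : 1 ≤ ε) (hδ : 0 < δ) (hδ1 : δ < 1) :
    ∃ A : QAlgorithm F,
    (A.program.queries : ℝ) ≤ 2000 / ε * Real.log (1 / δ) ∧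
    ∀ (R : Reward F) (O : Matrix.unitaryGroup F.Basis ℂ), R.BoundedValue → Encodes O R →
      (A.law O).toMeasure.real {x | ε ≤ |x - R.mean|} ≤ δ := by
  have hlog : 0 < Real.log (1 / δ) := Real.log_pos (by rw [lt_div_iff₀ hδ]; linarith)
  refine ⟨⟨0, .output (1 / 2)⟩, by simp only [QProgram.queries, Nat.cast_zero]; positivity, fun R O hR hO => ?_⟩
  obtain ⟨α, -, -, hα⟩ := exists_arccos hR
  have h1 := Real.cos_le_one α
  have h2 := Real.neg_one_le_cos α
  rw [MeasureTheory.measureReal_def,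
    PMF.toMeasure_apply_eq_toOuterMeasure_apply _ (measurableSet_error _ _),
    (PMF.toOuterMeasure_apply_eq_zero_iff _ _).2]
  · simpa using hδ.le
  · rw [Set.disjoint_left]
    intro x hx hx'
    have hx2 : x = 1 / 2 := by
      by_contra hne
      rw [PMF.mem_support_iff] at hx
      exact hx (Pi.single_eq_of_ne hne _)
    have h3 : ε ≤ |x - R.mean| := hx'
    have h4 : |x - R.mean| ≤ 1 / 2 := by
      rw [hx2, abs_le]; constructor <;> linarith
    linarith

/-- Since 1 - log(1/δ) ≤ δ, it suffices to succeed with probability log(1/δ). One outcome next to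
the true phase achieves this, even when the budget allows no query at all. -/
theorem exists_qmc_of_large_delta (F : Format) {ε δ : ℝ} (hε : 0 < ε) (hε1 : ε < 1) (hδ : 0 < δ)
    (hδ1 : δ < 1) (hl : Real.log (1 / δ) < 1 / 100) : ∃ A : QAlgorithm F,
    (A.program.queries : ℝ) ≤ 2000 / ε * Real.log (1 / δ) ∧
    ∀ (R : Reward F) (O : Matrix.unitaryGroup F.Basis ℂ), R.BoundedValue → Encodes O R →
      (A.law O).toMeasure.real {x | ε ≤ |x - R.mean|} ≤ δ := by
  classical
  have hlog : 0 < Real.log (1 / δ) := Real.log_pos (by rw [lt_div_iff₀ hδ]; linarith)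
  set lam := Real.log (1 / δ) with hlam
  -- As many walk steps as the budget allows, at two queries each.
  set L := ⌊2000 * lam / (2 * ε)⌋₊ with hLdef
  -- The grid spacing 2π/N is below 1/(L + 1), so the amplitudes at the nearby outcome add up
  -- coherently, and below 2ε, so its output is accurate.
  set N := 7 * (L + 1) + ⌈4 / ε⌉₊ with hNdef
  have hLN : L < N := by omega
  have hN0 : (0 : ℝ) < N := by
    have : 0 < N := by omega
    positivity
  have hL0 : (0 : ℝ) < (L : ℝ) + 1 := by positivity
  set c : Fin (L + 1) → ℂ := fun _ => (((√((L : ℝ) + 1))⁻¹ : ℝ) : ℂ) with hcdef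
  have hs : (√((L : ℝ) + 1))⁻¹ ^ 2 = ((L : ℝ) + 1)⁻¹ := by rw [inv_pow, Real.sq_sqrt hL0.le]
  have hc1 : ∑ m, ‖c m‖ ^ 2 = 1 := by
    simp only [hcdef, Complex.norm_real, Real.norm_eq_abs, sq_abs, hs]
    simp
    field_simp
  refine ⟨phaseEstimation F L N hLN c hc1 (phaseOutput _), ?_, ?_⟩
  · rw [queries_phaseEstimation]
    have h2 : (L : ℝ) ≤ 2000 * lam / (2 * ε) := Nat.floor_le (by positivity)
    push_cast
    calc 2 * (L : ℝ) ≤ 2 * (2000 * lam / (2 * ε)) := by gcongr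
      _ = _ := by field_simp
  · intro R O hR hO
    obtain ⟨α, hα0, hαpi, hα⟩ := exists_arccos hR
    rw [law_phaseEstimation_real hLN hc1 _ hR hO hα (measurableSet_error _ _)]
    have hpi := Real.pi_pos
    have hpi4 := Real.pi_lt_d2
    have hj0 : ⌊α * N / (2 * Real.pi)⌋₊ < N := by
      rw [Nat.floor_lt (by positivity), div_lt_iff₀ (by positivity)]
      nlinarith
    set j : Fin N := ⟨⌊α * N / (2 * Real.pi)⌋₊, hj0⟩ with hj
    set β : ℝ := α - 2 * Real.pi * (j : ℕ) / N with hβdef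
    have hβ0 : 0 ≤ β := by
      have h1 : ((j : ℕ) : ℝ) ≤ α * N / (2 * Real.pi) := Nat.floor_le (by positivity)
      rw [hβdef, sub_nonneg, div_le_iff₀ hN0]
      rwa [le_div_iff₀ (by positivity), mul_comm] at h1
    have hβ1 : β * N ≤ 2 * Real.pi := by
      have h1 : α * N / (2 * Real.pi) < ((j : ℕ) : ℝ) + 1 := Nat.lt_floor_add_one _
      rw [div_lt_iff₀ (by positivity)] at h1
      rw [hβdef, sub_mul, div_mul_cancel₀ _ hN0.ne']
      linarith
    have hy : star (zeta N ^ (j : ℕ)) * Complex.exp (α * Complex.I) =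
        Complex.exp (β * Complex.I) := by
      rw [zeta, ← Complex.exp_nat_mul, RCLike.star_def, ← Complex.exp_conj, ← Complex.exp_add]
      congr 1
      simp only [map_mul, map_div₀, Complex.conj_I, Complex.conj_ofReal, map_natCast, map_ofNat,
        hβdef]
      push_cast
      ring
    have hNL : 7 * ((L : ℝ) + 1) ≤ N := by
      rw [hNdef]; push_cast; linarith [Nat.cast_nonneg (α := ℝ) ⌈4 / ε⌉₊]
    have hNε : 4 ≤ N * ε := by
      rw [← div_le_iff₀ hε]
      refine (Nat.le_ceil (4 / ε)).trans ?_
      rw [hNdef]; push_cast; linarith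
    have hβL : |β| * ((L + 1 : ℕ) : ℝ) ≤ 1 := by
      rw [abs_of_nonneg hβ0]
      push_cast
      nlinarith
    have hβε : β < 2 * ε := by
      by_contra hcon
      rw [not_lt] at hcon
      nlinarith
    have hjout : phaseOutput N j ∉ {x | ε ≤ |x - R.mean|} := by
      change ¬ ε ≤ |phaseOutput N j - R.mean|
      rw [not_le]
      have h2 := abs_phaseOutput_sub_le j hα
        (Complex.exp_ofReal_mul_I_re α)
      rw [hy, mul_comm] at h2
      have h3 := Real.norm_exp_I_mul_ofReal_sub_one_le (x := β)
      rw [mul_comm, Real.norm_eq_abs, abs_of_nonneg hβ0] at h3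
      rw [mul_comm] at h3
      rw [mul_comm (β : ℂ)] at h2
      linarith
    have hprob : ((L : ℝ) + 1) / (8 * N) ≤ outcomeProb N c α j := by
      unfold outcomeProb
      have h1 : ((L : ℝ) + 1) / 4 ≤
          ‖∑ m, c m * Complex.exp (β * Complex.I) ^ (m : ℕ)‖ ^ 2 := by
        have h2 := le_norm_geom_sum hβL
        simp only [hcdef]
        rw [← Finset.mul_sum, norm_mul, mul_pow, Complex.norm_real, Real.norm_eq_abs, sq_abs, hs,
          Fin.sum_univ_eq_sum_range (fun i => Complex.exp (β * Complex.I) ^ i),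
          ← div_eq_inv_mul, le_div_iff₀ hL0]
        push_cast at h2
        nlinarith
      rw [hy]
      calc ((L : ℝ) + 1) / (8 * N) = (2 * N : ℝ)⁻¹ * (((L : ℝ) + 1) / 4 + 0) := by
            field_simp; ring
        _ ≤ _ := by gcongr; positivity
    have hsum := sum_outcomeProb (N := N) (show L + 1 ≤ N by omega) (by omega) c α
    rw [hc1] at hsum
    have hle : ∑ i with phaseOutput N i ∈ {x | ε ≤ |x - R.mean|}, outcomeProb N c α i +
        outcomeProb N c α j ≤ 1 := by
      rw [← hsum, add_comm, ← Finset.sum_insert (s := Finset.univ.filter fun i =>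
        phaseOutput N i ∈ {x | ε ≤ |x - R.mean|}) (f := outcomeProb N c α)
        (fun h => hjout (Finset.mem_filter.1 h).2)]
      exact Finset.sum_le_sum_of_subset_of_nonneg (Finset.subset_univ _)
        fun i _ _ => outcomeProb_nonneg c α i
    have hδlam : 1 - lam ≤ δ := by
      have h8 : Real.exp (-lam) = δ := by
        rw [hlam, one_div, Real.log_inv, neg_neg, Real.exp_log hδ]
      have := Real.add_one_le_exp (-lam)
      linarith
    have hlam' : lam ≤ ((L : ℝ) + 1) / (8 * N) := by
      rw [le_div_iff₀ (by positivity)]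
      have h1 : (N : ℝ) ≤ 7 * (L + 1) + 5 / ε := by
        rw [hNdef]; push_cast
        have h2 := (Nat.ceil_lt_add_one (show 0 ≤ 4 / ε by positivity)).le
        have h3 : 1 ≤ 1 / ε := by rw [le_div_iff₀ hε]; linarith
        have h4 : 4 / ε + 1 / ε = 5 / ε := by ring
        linarith
      have h2 : 1000 * lam / ε ≤ (L : ℝ) + 1 := by
        have := (Nat.lt_floor_add_one (2000 * lam / (2 * ε))).le
        rw [← hLdef] at this
        refine le_trans (le_of_eq ?_) this
        field_simp
        norm_num
      have h3 : lam * (8 * (5 / ε)) = 40 / 1000 * (1000 * lam / ε) := by ring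
      nlinarith
    linarith

theorem exists_isQMC : ∃ Q : (F : Format) → (ε δ : ℝ) → QAlgorithm F, IsQMC 2000 Q := by
  have h : ∀ (F : Format) (ε δ : ℝ), ∃ A : QAlgorithm F, 0 < ε → 0 < δ → δ < 1 →
      (A.program.queries : ℝ) ≤ 2000 / ε * Real.log (1 / δ) ∧
      ∀ (R : Reward F) (O : Matrix.unitaryGroup F.Basis ℂ), R.BoundedValue → Encodes O R →
        (A.law O).toMeasure.real {x | ε ≤ |x - R.mean|} ≤ δ := by
    intro F ε δ
    by_cases h0 : 0 < ε ∧ 0 < δ ∧ δ < 1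
    · obtain ⟨hε, hδ, hδ1⟩ := h0
      have h1 : ∃ A : QAlgorithm F, (A.program.queries : ℝ) ≤ 2000 / ε * Real.log (1 / δ) ∧
          ∀ (R : Reward F) (O : Matrix.unitaryGroup F.Basis ℂ), R.BoundedValue → Encodes O R →
            (A.law O).toMeasure.real {x | ε ≤ |x - R.mean|} ≤ δ := by
        rcases le_or_gt 1 ε with hε1 | hε1
        · exact exists_qmc_of_one_le F hε1 hδ hδ1
        · rcases le_or_gt (1 / 100) (Real.log (1 / δ)) with hl | hl
          · exact exists_qmc_of_small_delta F hε hδ hl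
          · exact exists_qmc_of_large_delta F hε hε1 hδ hδ1 hl
      exact h1.imp fun A hA _ _ _ => hA
    · exact ⟨⟨0, .output 0⟩, fun hε hδ hδ1 => absurd ⟨hε, hδ, hδ1⟩ h0⟩
  choose Q hQ using h
  exact ⟨Q, hQ⟩

/-! ### Union bounds for `PMF` -/

/-- One step of an adaptive union bound: S collects the failures of the current step, γ bounds the
failure of everything later. -/
theorem toOuterMeasure_bind_le {α β : Type*} (p : PMF α) (f : α → PMF β) (A : Set β) (S : Set α)
    (γ : ENNReal) (h : ∀ a, a ∉ S → (f a).toOuterMeasure A ≤ γ) :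
    (p.bind f).toOuterMeasure A ≤ p.toOuterMeasure S + γ := by
  rw [PMF.toOuterMeasure_bind_apply, PMF.toOuterMeasure_apply]
  calc ∑' a, p a * (f a).toOuterMeasure A ≤ ∑' a, (S.indicator p a + p a * γ) := by
        refine ENNReal.tsum_le_tsum fun a => ?_
        by_cases ha : a ∈ S
        · rw [Set.indicator_of_mem ha]
          refine le_add_right ?_
          calc p a * (f a).toOuterMeasure A ≤ p a * 1 := by
                gcongr
                rw [PMF.toOuterMeasure_apply, ← (f a).tsum_coe]
                exact ENNReal.tsum_le_tsum fun y => Set.indicator_le_self _ _ y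
            _ = p a := mul_one _
        · rw [Set.indicator_of_notMem ha, zero_add]
          gcongr
          exact h a ha
    _ = _ := by rw [ENNReal.tsum_add, ENNReal.tsum_mul_right, p.tsum_coe, one_mul]

theorem one_sub_le_map_real_Iic {α : Type*} (p : PMF α) (g : α → ℝ) (B β : ℝ) (hβ : 0 ≤ β)
    (h : p.toOuterMeasure {a | B < g a} ≤ ENNReal.ofReal β) :
    1 - β ≤ (p.map g).toMeasure.real (Set.Iic B) := by
  have h1 := MeasureTheory.probReal_compl_eq_one_sub (μ := (p.map g).toMeasure)
    (measurableSet_Ioi (a := B))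
  rw [Set.compl_Ioi] at h1
  rw [h1]
  have h2 : (p.map g).toMeasure.real (Set.Ioi B) ≤ β := by
    rw [MeasureTheory.measureReal_def,
      PMF.toMeasure_apply_eq_toOuterMeasure_apply _ measurableSet_Ioi, PMF.toOuterMeasure_map_apply]
    exact ENNReal.toReal_le_of_le_ofReal hβ h
  linarith

/-! ### Regret analysis of QUCB -/

/-- Number of rounds of the first `K` stages of an arm. -/
def totalLength (C δ : ℝ) (K : ℕ) : ℕ := ∑ k ∈ Finset.range K, stageLength C δ ((1 / 2) ^ k)

theorem totalLength_mono (C δ : ℝ) : Monotone (totalLength C δ) := fun _ _ h =>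
  Finset.sum_le_sum_of_subset (Finset.range_subset_range.2 h)

theorem totalLength_succ (C δ : ℝ) (K : ℕ) :
    totalLength C δ (K + 1) = totalLength C δ K + stageLength C δ ((1 / 2) ^ K) :=
  Finset.sum_range_succ _ _

theorem div_half_pow_mul (C lam : ℝ) (k : ℕ) : C / (1 / 2) ^ k * lam = C * lam * 2 ^ k := by
  rw [one_div, inv_pow, div_inv_eq_mul]
  ring

/-- A geometric sum; `hx` ensures that the minimum of one round per stage never exceeds the
unrounded length. -/
theorem totalLength_le {C δ : ℝ} (hx : 1 ≤ C * Real.log (1 / δ)) (K : ℕ) :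
    (totalLength C δ K : ℝ) ≤ C * Real.log (1 / δ) * (2 ^ K - 1) := by
  induction K with
  | zero => simp [totalLength]
  | succ K ih =>
    have h : (stageLength C δ ((1 / 2) ^ K) : ℝ) ≤ C * Real.log (1 / δ) * 2 ^ K := by
      have h1 : (1 : ℝ) ≤ 2 ^ K := one_le_pow₀ (by norm_num)
      rw [stageLength, div_half_pow_mul, Nat.cast_max]
      refine max_le ?_ (Nat.floor_le (by positivity))
      push_cast
      nlinarith
    rw [totalLength_succ, pow_succ]
    push_cast
    linarith

theorem le_totalLength (C δ : ℝ) (K : ℕ) :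
    C * Real.log (1 / δ) * (2 ^ K - 1) - K ≤ totalLength C δ K := by
  induction K with
  | zero => simp [totalLength]
  | succ K ih =>
    have h : C * Real.log (1 / δ) * 2 ^ K - 1 ≤ stageLength C δ ((1 / 2) ^ K) := by
      rw [stageLength, div_half_pow_mul, Nat.cast_max]
      refine le_max_of_le_right ?_
      linarith [Nat.lt_floor_add_one (C * Real.log (1 / δ) * 2 ^ K)]
    rw [totalLength_succ, pow_succ]
    push_cast
    linarith

section Analysis

variable {n : ℕ} (C δ : ℝ) (μ : Fin n → ℝ) (b : Fin n) (K T : ℕ)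

/-- The properties of the states after `c i` stages of the arms `i` that hold as long as no
relevant estimate fails.  The relevant estimates are the first `K` ones of the best arm `b` and, for
another arm, the one that first makes its confidence interval shorter than its gap. -/
structure Good (s : State n) (c : Fin n → ℕ) : Prop where
  -- For `c i = 0` the truncated subtraction gives radius 1, the initial value.
  radius : ∀ i, s.r i = (1 / 2) ^ (c i - 1)
  count_played : ∀ i, s.played.count i = totalLength C δ (c i)
  estimate : ∀ i, i ≠ b → 4 < 2 ^ c i * (μ b - μ i) → 2 ^ c i * (μ b - μ i) ≤ 8 →
    s.muHat i < μ i + s.r i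
  estimate_best : 1 ≤ c b → c b ≤ K → μ b < s.muHat b + s.r b
  -- Either no arm is over-explored, or the best arm has already filled enough of the first T
  -- rounds; the second alternative persists once reached.
  safe : (∀ i, i ≠ b → 2 ^ c i * (μ b - μ i) ≤ 8) ∨
    totalLength C δ (K + 1) ≤ (s.played.take T).count b

open Classical in
/-- Number of relevant estimates that are still to come after `c i` stages of the arms `i`. -/
def remaining (c : Fin n → ℕ) : ℕ :=
  ∑ i ∈ Finset.univ.erase b, (if 2 ^ c i * (μ b - μ i) ≤ 4 then 1 else 0) + (K - c b)

variable {μ b K T C δ}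

theorem remaining_update_le (hb : ∀ i, μ i ≤ μ b) (c : Fin n → ℕ) (i : Fin n) :
    remaining μ b K (Function.update c i (c i + 1)) ≤ remaining μ b K c := by
  unfold remaining
  have hle : ∀ j, c j ≤ Function.update c i (c i + 1) j := by
    intro j
    by_cases h : j = i
    · subst h; simp
    · simp [h]
  refine add_le_add (Finset.sum_le_sum fun j _ => ?_) (Nat.sub_le_sub_left (hle b) K)
  split_ifs with h1 h2
  · exact le_rfl
  · refine absurd (le_trans ?_ h1) h2
    gcongr
    · linarith [hb j]
    · norm_num
    · exact hle j
  · exact Nat.zero_le _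
  · exact le_rfl

theorem remaining_update_lt (hb : ∀ i, μ i ≤ μ b) (c : Fin n → ℕ) (i : Fin n)
    (h : (i ≠ b ∧ 2 ^ c i * (μ b - μ i) ≤ 4 ∧ 4 < 2 ^ (c i + 1) * (μ b - μ i)) ∨
      (i = b ∧ c b < K)) :
    remaining μ b K (Function.update c i (c i + 1)) + 1 ≤ remaining μ b K c := by
  have hle : ∀ j, c j ≤ Function.update c i (c i + 1) j := by
    intro j
    by_cases h : j = i
    · subst h; simp
    · simp [h]
  have hterm : ∀ j, (if 2 ^ (Function.update c i (c i + 1) j) * (μ b - μ j) ≤ 4 then 1 else 0) ≤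
      (if 2 ^ c j * (μ b - μ j) ≤ 4 then 1 else 0) := by
    intro j
    split_ifs with h1 h2
    · exact le_rfl
    · refine absurd (le_trans ?_ h1) h2
      gcongr
      · linarith [hb j]
      · norm_num
      · exact hle j
    · exact Nat.zero_le _
    · exact le_rfl
  unfold remaining
  rcases h with ⟨hib, h1, h2⟩ | ⟨rfl, h1⟩
  · have hlt : ∑ j ∈ Finset.univ.erase b,
        (if 2 ^ (Function.update c i (c i + 1) j) * (μ b - μ j) ≤ 4 then 1 else 0) <
        ∑ j ∈ Finset.univ.erase b, (if 2 ^ c j * (μ b - μ j) ≤ 4 then 1 else 0) := by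
      refine Finset.sum_lt_sum (fun j _ => hterm j)
        ⟨i, Finset.mem_erase.2 ⟨hib, Finset.mem_univ i⟩, ?_⟩
      rw [Function.update_self, if_neg (not_le.2 h2), if_pos h1]
      exact zero_lt_one
    have := Nat.sub_le_sub_left (hle b) K
    omega
  · have := Finset.sum_le_sum fun j (_ : j ∈ Finset.univ.erase i) => hterm j
    rw [Function.update_self]
    omega

variable {F : Format} {Q : (F : Format) → (ε δ : ℝ) → QAlgorithm F}
  {O : Fin n → Matrix.unitaryGroup F.Basis ℂ} {R : Fin n → Reward F}

/-- Accuracy of the new estimate is required only when the stage is relevant; by `hi`, doubling 2^c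
Δ keeps it at most 8 unless the best arm is already past its quota. -/
theorem Good.stage {s : State n} {c : Fin n → ℕ}
    (hs : Good C δ μ b K T s c) {i : Fin n}
    (hi : (i ≠ b → 2 ^ c i * (μ b - μ i) ≤ 4) ∨
      totalLength C δ (K + 1) ≤ (s.played.take T).count b) {x : ℝ}
    (hx : (i ≠ b ∧ 2 ^ c i * (μ b - μ i) ≤ 4 ∧ 4 < 2 ^ (c i + 1) * (μ b - μ i)) ∨
      (i = b ∧ c b < K) → |x - μ i| < (1 / 2) ^ c i) :
    Good C δ μ b K T
      { muHat := Function.update s.muHat i x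
        r := Function.update s.r i ((1 / 2) ^ c i)
        played := s.played ++ List.replicate (stageLength C δ ((1 / 2) ^ c i)) i
        history := s.history ++ [(i, x)] }
      (Function.update c i (c i + 1)) where
  radius j := by
    by_cases h : j = i
    · subst h; simp
    · simpa [h] using hs.radius j
  count_played j := by
    by_cases h : j = i
    · subst h
      simp [hs.count_played, totalLength_succ]
    · simp [h, hs.count_played, List.count_replicate, Ne.symm h]
  estimate j hj h1 h2 := by
    by_cases h : j = i
    · subst h
      simp only [Function.update_self] at h1 h2 ⊢
      have h3 : 2 ^ c j * (μ b - μ j) ≤ 4 := by rw [pow_succ] at h2; linarith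
      have h4 := abs_lt.1 (hx (Or.inl ⟨hj, h3, h1⟩))
      linarith [h4.2]
    · simp only [Function.update_of_ne h] at h1 h2 ⊢
      exact hs.estimate j hj h1 h2
  estimate_best h1 h2 := by
    by_cases h : b = i
    · subst h
      simp only [Function.update_self] at h1 h2 ⊢
      have h4 := abs_lt.1 (hx (Or.inr ⟨rfl, h2⟩))
      linarith [h4.1]
    · simp only [Function.update_of_ne h] at h1 h2 ⊢
      exact hs.estimate_best h1 h2
  safe := by
    have hW : totalLength C δ (K + 1) ≤ (s.played.take T).count b →
        totalLength C δ (K + 1) ≤ ((s.played ++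
          List.replicate (stageLength C δ ((1 / 2) ^ c i)) i).take T).count b := by
      intro h
      rw [List.take_append, List.count_append]
      exact le_add_right h
    by_cases hW' : totalLength C δ (K + 1) ≤ (s.played.take T).count b
    · exact Or.inr (hW hW')
    · refine Or.inl fun j hj => ?_
      have h1 := hs.safe.resolve_right hW'
      have h2 := hi.resolve_right hW'
      by_cases h : j = i
      · subst h
        rw [Function.update_self, pow_succ]
        linarith [h2 hj]
      · rw [Function.update_of_ne h]
        exact h1 j hj

theorem law_error_le (hδ : 0 < δ) (hδ1 : δ < 1) (hQ : IsQMC C Q) {ε : ℝ} (hε : 0 < ε)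
    {R : Reward F} {O : Matrix.unitaryGroup F.Basis ℂ} (hR : R.BoundedValue) (hO : Encodes O R) :
    ((Q F ε δ).law O).toOuterMeasure {x | ε ≤ |x - R.mean|} ≤ ENNReal.ofReal δ := by
  have h := (hQ F ε δ hε hδ hδ1).2 R O hR hO
  rw [← PMF.toMeasure_apply_eq_toOuterMeasure_apply _ (measurableSet_error _ _)]
  exact (ENNReal.le_ofReal_iff_toReal_le (MeasureTheory.measure_ne_top _ _) hδ.le).2 h

/-- A relevant stage spends one δ and lowers the potential by at least one; any other stage spends
nothing and does not raise it. -/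
theorem runStage_bind_le (hδ : 0 < δ) (hδ1 : δ < 1) (hQ : IsQMC C Q)
    (hR : ∀ i, (R i).BoundedValue) (hO : ∀ i, Encodes (O i) (R i))
    (hb : ∀ i, (R i).mean ≤ (R b).mean) {s : State n} {c : Fin n → ℕ}
    (hs : Good C δ (fun i => (R i).mean) b K T s c) {i : Fin n}
    (hi : (i ≠ b → 2 ^ c i * ((R b).mean - (R i).mean) ≤ 4) ∨
      totalLength C δ (K + 1) ≤ (s.played.take T).count b)
    {β : Type*} (f : State n → PMF β) (A : Set β)
    (hf : ∀ s', Good C δ (fun i => (R i).mean) b K T s' (Function.update c i (c i + 1)) →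
      (f s').toOuterMeasure A ≤ ENNReal.ofReal δ *
        remaining (fun i => (R i).mean) b K (Function.update c i (c i + 1))) :
    ((runStage C δ Q O i ((1 / 2) ^ c i) s).bind f).toOuterMeasure A ≤
      ENNReal.ofReal δ * remaining (fun i => (R i).mean) b K c := by
  classical
  rw [runStage, PMF.bind_map]
  by_cases hrel : (i ≠ b ∧ 2 ^ c i * ((R b).mean - (R i).mean) ≤ 4 ∧
      4 < 2 ^ (c i + 1) * ((R b).mean - (R i).mean)) ∨ (i = b ∧ c b < K)
  · have h1 := remaining_update_lt (μ := fun i => (R i).mean) hb c i hrel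
    refine (toOuterMeasure_bind_le _ _ A {x | (1 / 2) ^ c i ≤ |x - (R i).mean|} _
      fun x hx => hf _ (hs.stage hi fun _ => not_le.1 hx)).trans ?_
    calc _ ≤ ENNReal.ofReal δ + ENNReal.ofReal δ *
          remaining (fun i => (R i).mean) b K (Function.update c i (c i + 1)) := by
          gcongr
          exact law_error_le hδ hδ1 hQ (by positivity) (hR i) (hO i)
      _ = ENNReal.ofReal δ *
          ((remaining (fun i => (R i).mean) b K (Function.update c i (c i + 1)) + 1 : ℕ) :
            ENNReal) := by push_cast; ring
      _ ≤ _ := by gcongr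
  · refine (toOuterMeasure_bind_le _ _ A ∅ _
      fun x _ => hf _ (hs.stage hi fun h => absurd h hrel)).trans ?_
    rw [MeasureTheory.measure_empty, zero_add]
    gcongr
    exact remaining_update_le (μ := fun i => (R i).mean) hb c i

theorem mainLoop_le (hδ : 0 < δ) (hδ1 : δ < 1) (hQ : IsQMC C Q)
    (hR : ∀ i, (R i).BoundedValue) (hO : ∀ i, Encodes (O i) (R i))
    (hb : ∀ i, (R i).mean ≤ (R b).mean) {select : State n → Fin n} (hsel : IsUCBRule select)
    {A : Set (State n)}
    (hA : ∀ s c, Good C δ (fun i => (R i).mean) b K T s c → s ∉ A) (fuel : ℕ) :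
    ∀ (s : State n) (c : Fin n → ℕ), Good C δ (fun i => (R i).mean) b K T s c → (∀ i, 1 ≤ c i) →
      (mainLoop C δ Q O select T fuel s).toOuterMeasure A ≤
        ENNReal.ofReal δ * remaining (fun i => (R i).mean) b K c := by
  classical
  have hpure : ∀ s c, Good C δ (fun i => (R i).mean) b K T s c →
      (PMF.pure s).toOuterMeasure A ≤
        ENNReal.ofReal δ * remaining (fun i => (R i).mean) b K c := by
    intro s c hs
    rw [PMF.toOuterMeasure_pure_apply, if_neg (hA s c hs)]
    exact zero_le
  induction fuel with
  | zero => intro s c hs _; exact hpure s c hs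
  | succ fuel ih =>
    intro s c hs hc
    rw [mainLoop]
    split_ifs with hT
    · exact hpure s c hs
    · set i := select s with hi
      have hr : s.r i / 2 = (1 / 2) ^ c i := by
        rw [hs.radius i]
        obtain ⟨k, hk⟩ := Nat.exists_eq_succ_of_ne_zero (Nat.one_le_iff_ne_zero.1 (hc i))
        rw [hk, Nat.succ_eq_add_one, Nat.add_sub_cancel, pow_succ]
        ring
      rw [hr]
      refine runStage_bind_le hδ hδ1 hQ hR hO hb hs ?_ _ A fun s' hs' =>
        ih s' _ hs' fun j => ?_
      · by_cases hW : totalLength C δ (K + 1) ≤ (s.played.take T).count b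
        · exact Or.inr hW
        · refine Or.inl fun hib => ?_
          by_contra hcon
          rw [not_le] at hcon
          have h8 := hs.safe.resolve_right hW i hib
          have h1 : s.muHat i < (R i).mean + s.r i := hs.estimate i hib hcon h8
          have h2 := hsel s b
          rw [← hi] at h2
          -- Hence the upper bound of i is below μ(i) + 2r < μ(b). Its selection then forces the
          -- upper bound of b to have failed, so b has used up its K protected estimates.
          have h3 : 2 * s.r i < (R b).mean - (R i).mean := by
            have : s.r i = 2 * (1 / 2) ^ c i := by linarith
            rw [this, one_div, inv_pow]
            have hp : (0 : ℝ) < 2 ^ c i := by positivity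
            rw [← mul_assoc, ← div_eq_mul_inv, div_lt_iff₀ hp]
            linarith
          have h4 : K < c b := by
            by_contra hcb
            have h5 : (R b).mean < s.muHat b + s.r b := hs.estimate_best (hc b) (not_lt.1 hcb)
            linarith
          apply hW
          -- A new stage starts only before the horizon, so truncation at T removes nothing yet.
          rw [List.take_of_length_le (not_le.1 hT).le, hs.count_played]
          exact totalLength_mono C δ h4
      · by_cases h : j = i
        · subst h; simp
        · simpa [h] using hc j

theorem initialPhase_bind_le (hδ : 0 < δ) (hδ1 : δ < 1) (hQ : IsQMC C Q)
    (hR : ∀ i, (R i).BoundedValue) (hO : ∀ i, Encodes (O i) (R i))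
    (hb : ∀ i, (R i).mean ≤ (R b).mean) (hgap : ∀ i, (R b).mean - (R i).mean ≤ 1)
    {β : Type*} (f : State n → PMF β) (A : Set β)
    (hf : ∀ s c, Good C δ (fun i => (R i).mean) b K T s c → (∀ i, 1 ≤ c i) →
      (f s).toOuterMeasure A ≤ ENNReal.ofReal δ * remaining (fun i => (R i).mean) b K c) :
    ((initialPhase C δ Q O).bind f).toOuterMeasure A ≤
      ENNReal.ofReal δ * ((n - 1 + K : ℕ) : ENNReal) := by
  -- Induction over the arms still to be initialized. As gaps are at most 1, every arm starts with
  -- 2^0 Δ ≤ 4, so its relevant estimate lies ahead and the initial potential is n - 1 + K.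
  have key : ∀ (l : List (Fin n)) (s : State n) (c : Fin n → ℕ), l.Nodup →
      (∀ i, c i = if i ∈ l then 0 else 1) → Good C δ (fun i => (R i).mean) b K T s c →
      ((l.foldlM (fun s i => runStage C δ Q O i 1 s) s : PMF (State n)).bind f).toOuterMeasure A ≤
        ENNReal.ofReal δ * remaining (fun i => (R i).mean) b K c := by
    intro l
    induction l with
    | nil =>
      intro s c _ hc hs
      have : (([] : List (Fin n)).foldlM (fun s i => runStage C δ Q O i 1 s) s : PMF (State n)) =
        PMF.pure s := rfl
      rw [this, PMF.pure_bind]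
      exact hf s c hs fun i => by simp [hc]
    | cons i l ih =>
      intro s c hl hc hs
      have : ((i :: l).foldlM (fun s i => runStage C δ Q O i 1 s) s : PMF (State n)) =
        (runStage C δ Q O i 1 s).bind
          fun s' => l.foldlM (fun s i => runStage C δ Q O i 1 s) s' := rfl
      rw [this, PMF.bind_bind]
      have hci : c i = 0 := by simp [hc]
      have h1 : (1 : ℝ) = (1 / 2) ^ c i := by rw [hci, pow_zero]
      rw [List.nodup_cons] at hl
      have hstage := runStage_bind_le hδ hδ1 hQ hR hO hb hs (i := i)
        (Or.inl fun _ => by rw [hci, pow_zero, one_mul]; linarith [hgap i])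
        (fun s' => (l.foldlM (fun s i => runStage C δ Q O i 1 s) s' : PMF (State n)).bind f) A
        fun s' hs' => ih s' _ hl.2 (fun j => by
          by_cases h : j = i
          · subst h; simp [hci, hl.1]
          · simp [h, hc]) hs'
      rwa [← h1] at hstage
  have h := key (List.finRange n)
    { muHat := fun _ => 0, r := fun _ => 1, played := [], history := [] } (fun _ => 0) (List.nodup_finRange n) (by simp)
    { radius := by simp
      count_played := by simp [totalLength]
      estimate := fun i _ h _ => by
        simp only [pow_zero, one_mul] at h
        linarith [hgap i]
      estimate_best := fun h => absurd h (by norm_num)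
      safe := Or.inl fun i _ => by
        simp only [pow_zero, one_mul]
        linarith [hgap i] }
  refine h.trans (le_of_eq ?_)
  congr 2
  unfold remaining
  have h1 : ∀ i, (2 : ℝ) ^ 0 * ((R b).mean - (R i).mean) ≤ 4 := fun i => by
    rw [pow_zero, one_mul]; linarith [hgap i]
  simp only [h1, if_true]
  simp

/-! ### From the invariant to the regret -/

theorem regret_eq_sum (μ : Fin n → ℝ) (b : Fin n) (l : List (Fin n)) :
    regret μ b l = ∑ i ∈ Finset.univ.erase b, (l.count i : ℝ) * (μ b - μ i) := by
  have h : regret μ b l = ∑ i, (l.count i : ℝ) * (μ b - μ i) := by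
    induction l with
    | nil => simp [regret]
    | cons a l ih =>
      have : regret μ b (a :: l) = (μ b - μ a) + regret μ b l := by simp [regret]
      rw [this, ih]
      simp only [List.count_cons, Nat.cast_add, add_mul, Finset.sum_add_distrib]
      rw [add_comm]
      congr 1
      simp [Finset.sum_ite_eq]
  rw [h, ← Finset.add_sum_erase _ _ (Finset.mem_univ b)]
  simp

theorem regret_le_length {μ : Fin n → ℝ} {b : Fin n} (hgap : ∀ i, μ b - μ i ≤ 1)
    (l : List (Fin n)) : regret μ b l ≤ l.length := by
  have := List.sum_le_card_nsmul (l.map fun i => μ b - μ i) 1 (by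
    intro x hx
    obtain ⟨i, -, rfl⟩ := List.mem_map.1 hx
    exact hgap i)
  simpa [regret] using this

theorem Good.regret_le (hx : 1 ≤ C * Real.log (1 / δ)) (hb : ∀ i, μ i ≤ μ b)
    (hgap : ∀ i, μ b - μ i ≤ 1)
    (hK : 2 ≤ n → 8 * ((n : ℝ) - 1) * (C * Real.log (1 / δ)) < T →
      (T : ℝ) ≤ 8 * (C * Real.log (1 / δ)) + totalLength C δ (K + 1))
    {s : State n} {c : Fin n → ℕ} (hs : Good C δ μ b K T s c) :
    regret μ b (s.played.take T) ≤ 8 * ((n : ℝ) - 1) * (C * Real.log (1 / δ)) := by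
  set x := C * Real.log (1 / δ) with hxdef
  have hcard : ((Finset.univ.erase b).card : ℝ) = n - 1 := by
    rw [Finset.card_erase_of_mem (Finset.mem_univ b), Finset.card_univ, Fintype.card_fin,
      Nat.cast_sub (Fin.pos b)]
    simp
  have hconst : 8 * ((n : ℝ) - 1) * x = ∑ _i ∈ Finset.univ.erase b, 8 * x := by
    rw [Finset.sum_const, nsmul_eq_mul, hcard]
    ring
  by_contra hcon
  rw [not_le] at hcon
  have hT : 8 * ((n : ℝ) - 1) * x < T := by
    refine hcon.trans_le ((regret_le_length hgap _).trans ?_)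
    exact_mod_cast List.length_take_le _ _
  rw [regret_eq_sum, hconst] at hcon
  -- If the bound fails, some single arm contributes more than 8x. Both alternatives of `safe`
  -- exclude this: the first by the length of its stages, the second because b leaves at most 8x
  -- rounds.
  obtain ⟨i, hi, hlt⟩ := Finset.exists_lt_of_sum_lt hcon
  have hib := (Finset.mem_erase.1 hi).1
  have hΔ : 0 ≤ μ b - μ i := sub_nonneg.2 (hb i)
  rcases hs.safe with h | h
  · have h1 : ((s.played.take T).count i : ℝ) ≤ totalLength C δ (c i) := by
      rw [← hs.count_played]
      exact_mod_cast (List.take_sublist T s.played).count_le i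
    have h2 := totalLength_le hx (c i)
    have h3 := h i hib
    have h4 : ((s.played.take T).count i : ℝ) * (μ b - μ i) ≤ x * 2 ^ c i * (μ b - μ i) := by
      gcongr
      linarith
    nlinarith
  · have h1 : (s.played.take T).count i + (s.played.take T).count b ≤ T := by
      refine le_trans ?_ (List.length_take_le T s.played)
      have hc : ∀ l : List (Fin n), l.count i + l.count b ≤ l.length := by
        intro l
        induction l with
        | nil => simp
        | cons a l ih =>
          simp only [List.count_cons, List.length_cons, beq_iff_eq]
          split_ifs with h1 h2
          · exact absurd (h1.symm.trans h2) hib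
          · omega
          · omega
          · omega
      exact hc _
    have h2 : ((s.played.take T).count i : ℝ) * (μ b - μ i) ≤ (s.played.take T).count i :=
      mul_le_of_le_one_right (Nat.cast_nonneg _) (hgap i)
    have hn : 2 ≤ n := by
      have := Fin.val_ne_of_ne hib
      omega
    have h3 := hK hn hT
    have h4 : ((s.played.take T).count i : ℝ) + (s.played.take T).count b ≤ T := by
      exact_mod_cast h1
    have h5 : (totalLength C δ (K + 1) : ℝ) ≤ (s.played.take T).count b := by exact_mod_cast h
    linarith

theorem qucb_bad_le (hδ : 0 < δ) (hδ1 : δ < 1) (hQ : IsQMC C Q)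
    (hR : ∀ i, (R i).BoundedValue) (hO : ∀ i, Encodes (O i) (R i))
    (hb : ∀ i, (R i).mean ≤ (R b).mean) (hgap : ∀ i, (R b).mean - (R i).mean ≤ 1)
    {select : State n → Fin n} (hsel : IsUCBRule select) (hx : 1 ≤ C * Real.log (1 / δ))
    (hK : 2 ≤ n → 8 * ((n : ℝ) - 1) * (C * Real.log (1 / δ)) < T →
      (T : ℝ) ≤ 8 * (C * Real.log (1 / δ)) + totalLength C δ (K + 1)) :
    (qucb C δ Q O select T).toOuterMeasure
      {l | 8 * ((n : ℝ) - 1) * (C * Real.log (1 / δ)) < regret (fun i => (R i).mean) b l} ≤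
      ENNReal.ofReal δ * ((n - 1 + K : ℕ) : ENNReal) := by
  rw [qucb, PMF.toOuterMeasure_map_apply]
  exact initialPhase_bind_le hδ hδ1 hQ hR hO hb hgap _ _ fun s c hs hc =>
    mainLoop_le hδ hδ1 hQ hR hO hb hsel
      (fun s c hs => not_lt.2 (hs.regret_le hx hb hgap hK)) T s c hs hc

end Analysis

/-! ### The number of relevant estimates -/

theorem two_mul_le_pow_of_three_le {n : ℕ} (hn : 3 ≤ n) :
    2 * (n : ℝ) ≤ (8 / 3) ^ (n - 1) := by
  induction n, hn using Nat.le_induction with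
  | base => norm_num
  | succ n hn ih =>
    have h3 : (3 : ℝ) ≤ n := by exact_mod_cast hn
    obtain ⟨k, rfl⟩ := Nat.exists_eq_add_of_le hn
    rw [show 3 + k + 1 - 1 = (3 + k - 1) + 1 by omega, pow_succ]
    push_cast at ih h3 ⊢
    linarith

/-- Here τ plays T/(nx), and the term -k is the loss from rounding down k stage lengths. -/
theorem two_pow_le_pow {n k : ℕ} (hn : 2 ≤ n) {τ : ℝ} (hτ : 8 * ((n : ℝ) - 1) < n * τ)
    (h : 7 + (2 : ℝ) ^ k - k ≤ n * τ) : (2 : ℝ) ^ (n - 1 + k) ≤ τ ^ n := by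
  have hn' : (2 : ℝ) ≤ n := by exact_mod_cast hn
  have hτ4 : 4 ≤ τ := by
    have : n * (4 : ℝ) < n * τ := by linarith
    exact (lt_of_mul_lt_mul_left this (by linarith)).le
  have hsucc : τ ^ n = τ ^ (n - 1) * τ := by
    rw [← pow_succ, Nat.sub_add_cancel (by omega)]
  have hpow : (0 : ℝ) < 2 ^ (n - 1) := by positivity
  -- For k ≤ 7 the constant 7 absorbs the loss and 2^k ≤ nτ. For larger k the loss is at most half
  -- of 2^k; the resulting factor 2 is paid for by τ ≥ 16/3 when n ≥ 3, and by the size of τ when n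
  -- = 2.
  rcases le_or_gt k 7 with hk | hk
  · have hk' : (k : ℝ) ≤ 7 := by exact_mod_cast hk
    have hn2 : (n : ℝ) ≤ 2 ^ (n - 1) := by
      have := Nat.lt_two_pow_self (n := n - 1)
      exact_mod_cast (by omega : n ≤ 2 ^ (n - 1))
    rw [pow_add, hsucc]
    calc (2 : ℝ) ^ (n - 1) * 2 ^ k ≤ 2 ^ (n - 1) * (2 ^ (n - 1) * τ) := by
          refine mul_le_mul_of_nonneg_left ?_ hpow.le
          have : (n : ℝ) * τ ≤ 2 ^ (n - 1) * τ := by gcongr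
          linarith
      _ = 4 ^ (n - 1) * τ := by rw [← mul_assoc, ← mul_pow]; norm_num
      _ ≤ _ := by gcongr
  · have hk1 : (k : ℝ) ≤ 2 ^ k / 2 := by
      have h1 : k ≤ 2 ^ (k - 1) := by
        have := Nat.lt_two_pow_self (n := k - 1)
        omega
      have h2 : (2 : ℝ) ^ k = 2 ^ (k - 1) * 2 := by
        rw [← pow_succ, Nat.sub_add_cancel (by omega)]
      rw [h2]
      have h3 : (k : ℝ) ≤ 2 ^ (k - 1) := by exact_mod_cast h1
      linarith
    have hk2 : (256 : ℝ) ≤ 2 ^ k := by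
      calc (256 : ℝ) = 2 ^ 8 := by norm_num
        _ ≤ 2 ^ k := pow_le_pow_right₀ (by norm_num) hk
    have hkτ : (2 : ℝ) ^ k ≤ 2 * n * τ := by linarith
    rcases Nat.eq_or_lt_of_le hn with rfl | hn3
    · norm_num [pow_add] at hkτ h ⊢
      nlinarith
    · have hn3' : (3 : ℝ) ≤ n := by exact_mod_cast hn3
      have hτ5 : 16 / 3 ≤ τ := by
        have : n * (16 / 3 : ℝ) < n * τ := by linarith
        exact (lt_of_mul_lt_mul_left this (by linarith)).le
      rw [pow_add, hsucc]
      calc (2 : ℝ) ^ (n - 1) * 2 ^ k ≤ 2 ^ (n - 1) * ((8 / 3) ^ (n - 1) * τ) := by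
            refine mul_le_mul_of_nonneg_left (hkτ.trans ?_) hpow.le
            have := two_mul_le_pow_of_three_le hn3
            gcongr
        _ = (16 / 3) ^ (n - 1) * τ := by rw [← mul_assoc, ← mul_pow]; norm_num
        _ ≤ _ := by gcongr

/-- If K + 1 stages of the best arm left more than 8x rounds, `two_pow_le_pow` with k = K + 1 would
give n - 1 + k ≤ n log₂ τ, one more than the floor defining K permits. -/
theorem le_totalLength_of_floor {n T : ℕ} (hn : 2 ≤ n) {C δ : ℝ}
    (hx : 1 ≤ C * Real.log (1 / δ)) (hT : 8 * ((n : ℝ) - 1) * (C * Real.log (1 / δ)) < T) :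
    (T : ℝ) ≤ 8 * (C * Real.log (1 / δ)) + totalLength C δ
      (⌊n * Real.logb 2 (T / (n * (C * Real.log (1 / δ))))⌋₊ - (n - 1) + 1) := by
  set x := C * Real.log (1 / δ) with hxdef
  set τ : ℝ := T / (n * x) with hτdef
  set k := ⌊n * Real.logb 2 τ⌋₊ - (n - 1) + 1 with hk
  by_contra hcon
  rw [not_le] at hcon
  have hx0 : 0 < x := by linarith
  have hn' : (2 : ℝ) ≤ n := by exact_mod_cast hn
  have hTx : (T : ℝ) = n * τ * x := by
    rw [hτdef]
    field_simp
  have h1 := le_totalLength C δ k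
  rw [← hxdef] at h1
  have h2 : 8 * ((n : ℝ) - 1) < n * τ := by
    rw [hTx] at hT
    exact lt_of_mul_lt_mul_right hT hx0.le
  have h3 : 7 + (2 : ℝ) ^ k - k ≤ n * τ := by
    refine le_of_mul_le_mul_right ?_ hx0
    rw [← hTx]
    have : (k : ℝ) ≤ k * x := le_mul_of_one_le_right (Nat.cast_nonneg _) hx
    linarith
  have h4 := two_pow_le_pow hn h2 h3
  have hτ0 : 0 < τ := by
    have : (0 : ℝ) < n * τ := by linarith
    exact pos_of_mul_pos_right this (by linarith)
  have h5 : ((n - 1 + k : ℕ) : ℝ) ≤ n * Real.logb 2 τ := by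
    have h6 := Real.logb_le_logb_of_le (b := 2) (by norm_num) (by positivity) h4
    rwa [Real.logb_pow, Real.logb_pow, Real.logb_self_eq_one (by norm_num), mul_one] at h6
  have h6 := Nat.le_floor h5
  omega

/-! ### The regret bound, by cases -/

theorem mean_mem {F : Format} {R : Reward F} (hR : R.BoundedValue) : R.mean ∈ Set.Icc (0 : ℝ) 1 := by
  obtain ⟨α, -, -, hα⟩ := exists_arccos hR
  constructor <;> linarith [Real.cos_le_one α, Real.neg_one_le_cos α]

theorem qucb_regret {C : ℝ} {Q : (F : Format) → (ε δ : ℝ) → QAlgorithm F} (hC : 1 < C)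
    (hQ : IsQMC C Q) {n : ℕ} {F : Format} {R : Fin n → Reward F}
    {O : Fin n → Matrix.unitaryGroup F.Basis ℂ} (hR : ∀ i, (R i).BoundedValue)
    (hO : ∀ i, Encodes (O i) (R i)) {b : Fin n} (hb : ∀ i, (R i).mean ≤ (R b).mean)
    {select : State n → Fin n} (hsel : IsUCBRule select) {δ : ℝ} {T : ℕ} (hδ : 0 < δ)
    (hδ1 : δ < 1) (hT : (n : ℝ) * (C * Real.log (1 / δ)) ≤ T) :
    1 - n * δ * Real.logb 2 (T / (n * (C * Real.log (1 / δ)))) ≤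
      ((qucb C δ Q O select T).map (regret (fun i => (R i).mean) b)).toMeasure.real
        (Set.Iic (8 * ((n : ℝ) - 1) * (C * Real.log (1 / δ)))) := by
  set x := C * Real.log (1 / δ) with hxdef
  set τ : ℝ := T / (n * x) with hτdef
  have hlog : 0 < Real.log (1 / δ) := Real.log_pos (by rw [lt_div_iff₀ hδ]; linarith)
  have hx0 : 0 < x := by positivity
  have hn1 : 1 ≤ n := Fin.pos b
  have hn1' : (1 : ℝ) ≤ n := by exact_mod_cast hn1
  have hgap : ∀ i, (R b).mean - (R i).mean ≤ 1 := fun i => by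
    linarith [(mean_mem (hR b)).2, (mean_mem (hR i)).1]
  have hτ1 : 1 ≤ τ := by rwa [hτdef, one_le_div (by positivity)]
  have hlogτ : 0 ≤ Real.logb 2 τ := Real.logb_nonneg (by norm_num) hτ1
  have hβ : 0 ≤ n * δ * Real.logb 2 τ := by positivity
  by_cases hTle : (T : ℝ) ≤ 8 * ((n : ℝ) - 1) * x
  · refine one_sub_le_map_real_Iic _ _ _ _ hβ (le_trans (le_of_eq ?_) zero_le)
    rw [PMF.toOuterMeasure_apply_eq_zero_iff, Set.disjoint_left]
    intro l hl hl'
    rw [qucb, PMF.mem_support_map_iff] at hl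
    obtain ⟨s, -, rfl⟩ := hl
    have h1 := regret_le_length (μ := fun i => (R i).mean) (b := b) hgap (s.played.take T)
    have h2 : ((s.played.take T).length : ℝ) ≤ T := by exact_mod_cast List.length_take_le _ _
    have h3 : 8 * ((n : ℝ) - 1) * x < regret (fun i => (R i).mean) b (s.played.take T) := hl'
    linarith
  rw [not_le] at hTle
  have hτ8 : 8 * ((n : ℝ) - 1) < n * τ := by
    have : (T : ℝ) = n * τ * x := by
      rw [hτdef]
      field_simp
    rw [this] at hTle
    exact lt_of_mul_lt_mul_right hTle hx0.le
  have hlog2 : 2 ≤ n → 2 ≤ Real.logb 2 τ := by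
    intro hn
    have hn' : (2 : ℝ) ≤ n := by exact_mod_cast hn
    have : n * (4 : ℝ) < n * τ := by linarith
    have h4 := (lt_of_mul_lt_mul_left this (by linarith)).le
    rw [Real.le_logb_iff_rpow_le (by norm_num) (by linarith)]
    norm_num
    exact h4
  rcases Nat.eq_or_lt_of_le hn1 with hn | hn2
  · subst hn
    refine one_sub_le_map_real_Iic _ _ _ _ hβ (le_trans (le_of_eq ?_) zero_le)
    rw [PMF.toOuterMeasure_apply_eq_zero_iff, Set.disjoint_left]
    intro l _ hl
    have h3 : 8 * (((1 : ℕ) : ℝ) - 1) * x < regret (fun i => (R i).mean) b l := hl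
    rw [regret_eq_sum] at h3
    have : Finset.univ.erase b = ∅ := by
      ext i
      simp [Subsingleton.elim i b]
    rw [this, Finset.sum_empty] at h3
    norm_num at h3
  have hn2' : (2 : ℝ) ≤ n := by exact_mod_cast hn2
  have hlog2' := hlog2 hn2
  -- For x < 1, C > 1 gives δ ≥ 1/e > 1/3. With n ≥ 2 and log₂ τ ≥ 2 the claimed probability is
  -- negative.
  rcases lt_or_ge x 1 with hx | hx
  · refine le_trans ?_ MeasureTheory.measureReal_nonneg
    have h1 : Real.log (1 / δ) ≤ 1 := by
      rw [hxdef] at hx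
      nlinarith
    have h2 : 1 / 3 ≤ δ := by
      rw [one_div, Real.log_inv] at h1
      have h3 : Real.exp (-1) ≤ δ := by
        rw [← Real.exp_log hδ]
        exact Real.exp_le_exp.2 (by linarith)
      refine le_trans ?_ h3
      rw [Real.exp_neg, one_div]
      exact inv_anti₀ (Real.exp_pos 1) (Real.exp_one_lt_d9.le.trans (by norm_num))
    have h3 : (2 : ℝ) * (1 / 3) * 2 ≤ n * δ * Real.logb 2 τ := by gcongr
    linarith
  · set K := ⌊n * Real.logb 2 τ⌋₊ - (n - 1) with hK
    have h := qucb_bad_le (K := K) (T := T) hδ hδ1 hQ hR hO hb hgap hsel hx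
      fun hn hT => le_totalLength_of_floor hn hx hT
    refine one_sub_le_map_real_Iic _ _ _ _ hβ (h.trans ?_)
    rw [← ENNReal.ofReal_natCast, ← ENNReal.ofReal_mul hδ.le]
    refine ENNReal.ofReal_le_ofReal ?_
    -- So the subtraction in K is not truncated, and exactly ⌊n log₂ τ⌋ estimates enter the union
    -- bound.
    have h5 : n - 1 ≤ ⌊n * Real.logb 2 τ⌋₊ := by
      refine Nat.le_floor ?_
      have : ((n - 1 : ℕ) : ℝ) ≤ n := by exact_mod_cast Nat.sub_le _ _
      nlinarith
    have h6 : n - 1 + K = ⌊n * Real.logb 2 τ⌋₊ := by omega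
    rw [h6]
    have h7 : (⌊n * Real.logb 2 τ⌋₊ : ℝ) ≤ n * Real.logb 2 τ := Nat.floor_le (by positivity)
    calc δ * (⌊n * Real.logb 2 τ⌋₊ : ℝ) ≤ δ * (n * Real.logb 2 τ) := by gcongr
      _ = _ := by ring

end QBandit

end

theorem theorem1 :
    (∃ C₁ : ℝ, 1 < C₁ ∧
      ∃ Q : (F : QBandit.Format) → (ε δ : ℝ) → QBandit.QAlgorithm F, QBandit.IsQMC C₁ Q) ∧
    ∀ (C₁ : ℝ) (Q : (F : QBandit.Format) → (ε δ : ℝ) → QBandit.QAlgorithm F),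
      1 < C₁ → QBandit.IsQMC C₁ Q →
      ∀ (n : ℕ) (F : QBandit.Format) (R : Fin n → QBandit.Reward F)
        (O : Fin n → Matrix.unitaryGroup F.Basis ℂ),
        (∀ i, (R i).BoundedValue) → (∀ i, QBandit.Encodes (O i) (R i)) →
      ∀ best : Fin n, (∀ i, (R i).mean ≤ (R best).mean) →
      ∀ select : QBandit.State n → Fin n, QBandit.IsUCBRule select →
      ∀ (δ : ℝ) (T : ℕ), 0 < δ → δ < 1 → (n : ℝ) * C₁ * Real.log (1 / δ) ≤ (T : ℝ) →
        1 - (n : ℝ) * δ * Real.logb 2 ((T : ℝ) / ((n : ℝ) * C₁ * Real.log (1 / δ))) ≤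
          ((QBandit.qucb C₁ δ Q O select T).map
              (QBandit.regret (fun i => (R i).mean) best)).toMeasure.real
            (Set.Iic (8 * ((n : ℝ) - 1) * C₁ * Real.log (1 / δ))) := by
  refine ⟨⟨2000, by norm_num, QBandit.exists_isQMC⟩, ?_⟩
  intro C₁ Q hC hQ n F R O hR hO best hbest select hsel δ T hδ hδ1 hT
  have h := QBandit.qucb_regret hC hQ hR hO hbest hsel hδ hδ1 (by rwa [← mul_assoc])
  simpa only [mul_assoc] using h
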